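/- All topological groups are Hausdorff, all representations and actions are continuous (i.e. their orbital maps are continuous), and a \emph{morphism} is a continuous group homomorphism. \textbf{Definitions.} Let $G$ be a locally compact group and $X\subset G$ a subset. A function $\varphi:G\to\mathbf C$ is positive definite if $\varphi(g)=\overline{\varphi(g^{-1})}$ for all $g$ and $\sum_{i,j}c_i\overline{c_j}\,\varphi(g_i^{-1}g_j)\ge 0$ for all $n$, $g_1,\dots,g_n\in G$, $c_1,\dots,c_n\in\mathbf C$; it is normalized if $\varphi(1)=1$. A function $\psi:G\to\mathbf R$ is conditionally negative definite if $\psi(1)=0$, $\psi(g)=\psi(g^{-1})$ for all $g$, and $\sum_{i,j}c_ic_j\,\psi(g_i^{-1}g_j)\le 0$ for all $n$, $g_1,\dots,g_n\in G$ and $c_1,\dots,c_n\in\mathbf R$ with $\sum_i c_i=0$. The pair $(G,X)$ has \emph{relative Property (T)} if every net of continuous normalized positive definite functions on $G$ that converges to $1$ uniformly on compact subsets converges to $1$ uniformly on $X$. It has \emph{relative Property (FH)} if every continuous conditionally negative definite function on $G$ is bounded on $X$. A unitary representation $\pi$ of $G$ on a Hilbert space \emph{almost has invariant vectors}, written $1_G\prec\pi$,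 if for every compact $K\subset G$ and every $\varepsilon>0$ there is a nonzero vector $\xi$ with $\|\pi(g)\xi-\xi\|\le\varepsilon\|\xi\|$ for all $g\in K$. Let $f:G\to Q$ be a morphism with dense image between locally compact groups. If $\pi$ is a unitary representation of $G$ on $\mathscr H$, let $\mathscr H^Q$ be the subspace of those $\xi\in\mathscr H$ such that $g\mapsto\pi(g)\xi$ factors as $w\circ f$ for a continuous map $w:Q\to\mathscr H$; it is $G$-invariant and the action of $G$ on it factors through a unitary representation $\pi^Q$ of $Q$. The morphism $f$ is a \emph{resolution} if, for every unitary representation $\pi$ of $G$, $1_G\prec\pi$ implies $1_Q\prec\pi^Q$. It is an \emph{affine resolution} if, for every isometric action of $G$ on an affine Hilbert space, there is a non-empty $G$-invariant affine subspace such that the action of $G$ on this subspace factors through (an isometric action of) $Q$. \textbf{Theorem.} Let $G,Q$ be locally compact groups and $f:G\to Q$ a morphism with dense image. Consider the following conditions: \begin{itemize} \item[(1)] $f:G\to Q$ is a resolution. \item[(2)] $(G,X)$ has relative Property (T) for all subsets $X\subset G$ such that $\overline{f(X)}$ is compact. \item[(3)] $(G,X)$ has relative Property (FH) for all subsets $X\subset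 G$ such that $\overline{f(X)}$ is compact. \item[(4)] $f:G\to Q$ is an affine resolution. \end{itemize} Then the implications (1)$\Rightarrow$(2)$\Rightarrow$(3)$\Leftrightarrow$(4) hold. Moreover, if $G$ is $\sigma$-compact, then (4)$\Rightarrow$(1), so that all four conditions are equivalent. -/

import Mathlib

open Filter Topology

universe u v

namespace RelativeT

/-! ### Positive definite and conditionally negative definite functions -/

/-- Positive definite functions on a group. Hermitian symmetry makes the double sum real, so that
its non-negativity is that of its real part. -/
def IsPositiveDefinite {G : Type*} [Group G] (φ : G → ℂ) : Prop :=
  (∀ g : G, φ g = star (φ g⁻¹)) ∧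
    ∀ (n : ℕ) (g : Fin n → G) (c : Fin n → ℂ),
      0 ≤ (∑ i, ∑ j, c i * star (c j) * φ ((g i)⁻¹ * g j)).re

/-- Conditionally negative definite functions on a group. -/
def IsCondNegDefinite {G : Type*} [Group G] (ψ : G → ℝ) : Prop :=
  ψ 1 = 0 ∧ (∀ g : G, ψ g = ψ g⁻¹) ∧
    ∀ (n : ℕ) (g : Fin n → G) (c : Fin n → ℝ), ∑ i, c i = 0 →
      ∑ i, ∑ j, c i * c j * ψ ((g i)⁻¹ * g j) ≤ 0

/-- Relative Property (T) of the pair `(G, X)`, for a subset `X`: every net of continuous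
normalized positive definite functions that converges to `1` uniformly on compact subsets
converges to `1` uniformly on `X`. (Nets indexed by directed sets in the universe of `G` suffice,
for instance the directed set of all pairs of a compact subset and a positive integer.) -/
def RelativePropertyT (G : Type u) [Group G] [TopologicalSpace G] (X : Set G) : Prop :=
  ∀ (ι : Type u) [Nonempty ι] [Preorder ι] [IsDirectedOrder ι] (φ : ι → G → ℂ),
    (∀ i, Continuous (φ i) ∧ IsPositiveDefinite (φ i) ∧ φ i 1 = 1) →
    (∀ K : Set G, IsCompact K → TendstoUniformlyOn φ (fun _ => 1) atTop K) →
    TendstoUniformlyOn φ (fun _ => 1) atTop X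

/-- Relative Property (FH) of the pair `(G, X)`: every continuous conditionally negative definite
function on `G` is bounded on `X`. -/
def RelativePropertyFH (G : Type*) [Group G] [TopologicalSpace G] (X : Set G) : Prop :=
  ∀ ψ : G → ℝ, Continuous ψ → IsCondNegDefinite ψ → Bornology.IsBounded (ψ '' X)

/-! ### Unitary representations -/

/-- A (strongly continuous) unitary representation of `G` on `H`. -/
structure UnitaryRep (G : Type*) [Group G] [TopologicalSpace G]
    (H : Type*) [NormedAddCommGroup H] [InnerProductSpace ℂ H] where
  toHom : G →* (H ≃ₗᵢ[ℂ] H)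
  continuous_orbit : ∀ ξ : H, Continuous fun g => toHom g ξ

/-- `1 ≺ π`: the representation almost has invariant vectors. -/
def UnitaryRep.AlmostHasInvariantVectors {G : Type*} [Group G] [TopologicalSpace G]
    {H : Type*} [NormedAddCommGroup H] [InnerProductSpace ℂ H] (π : UnitaryRep G H) : Prop :=
  ∀ K : Set G, IsCompact K → ∀ ε : ℝ, 0 < ε →
    ∃ ξ : H, ξ ≠ 0 ∧ ∀ g ∈ K, ‖π.toHom g ξ - ξ‖ ≤ ε * ‖ξ‖

/-! ### `Q`-vectors and the representation they carry -/

section QVectors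

variable {G Q : Type*} [Group G] [TopologicalSpace G] [Group Q] [TopologicalSpace Q]

/-- A function `u` on `G` factors (continuously) through `f : G → Q`. -/
def FactorsThroughMor (f : G →ₜ* Q) {Y : Type*} [TopologicalSpace Y] (u : G → Y) : Prop :=
  ∃ w : Q → Y, Continuous w ∧ ∀ g, u g = w (f g)

variable {H : Type*} [NormedAddCommGroup H] [InnerProductSpace ℂ H]

/-- The subspace of `Q`-vectors of a unitary representation of `G`: the vectors whose orbital map
factors through `Q`. -/
def UnitaryRep.qVectors (π : UnitaryRep G H) (f : G →ₜ* Q) : Submodule ℂ H where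
  carrier := {ξ | FactorsThroughMor f fun g => π.toHom g ξ}
  zero_mem' := ⟨fun _ => 0, continuous_const, fun g => by simp⟩
  add_mem' := by
    rintro ξ η ⟨w, hw, hξ⟩ ⟨z, hz, hη⟩
    exact ⟨fun q => w q + z q, hw.add hz, fun g => by simp [← hξ, ← hη]⟩
  smul_mem' := by
    rintro c ξ ⟨w, hw, hξ⟩
    exact ⟨fun q => c • w q, hw.const_smul c, fun g => by simp [← hξ]⟩

/-- The extension to `Q` of the orbital map of a `Q`-vector. -/
noncomputable def UnitaryRep.qOrbit (π : UnitaryRep G H) (f : G →ₜ* Q) (ξ : π.qVectors f) :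
    Q → H :=
  Classical.choose ξ.2

variable (π : UnitaryRep G H) {f : G →ₜ* Q}

theorem UnitaryRep.continuous_qOrbit (ξ : π.qVectors f) : Continuous (π.qOrbit f ξ) :=
  (Classical.choose_spec ξ.2).1

theorem UnitaryRep.qOrbit_apply (ξ : π.qVectors f) (g : G) :
    π.qOrbit f ξ (f g) = π.toHom g ξ :=
  ((Classical.choose_spec ξ.2).2 g).symm

theorem UnitaryRep.qOrbit_unique (hf : DenseRange f) (ξ : π.qVectors f) {w : Q → H}
    (hw : Continuous w) (h : ∀ g, w (f g) = π.toHom g ξ) : π.qOrbit f ξ = w :=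
  hf.equalizer (π.continuous_qOrbit ξ) hw (funext fun g => by simp [qOrbit_apply, h])

theorem UnitaryRep.norm_qOrbit (hf : DenseRange f) (ξ : π.qVectors f) (q : Q) :
    ‖π.qOrbit f ξ q‖ = ‖ξ‖ := by
  have : (fun q => ‖π.qOrbit f ξ q‖) = fun _ => ‖ξ‖ :=
    hf.equalizer (π.continuous_qOrbit ξ).norm continuous_const
      (funext fun k => by simp [qOrbit_apply])
  exact congrFun this q

theorem UnitaryRep.qOrbit_one (ξ : π.qVectors f) : π.qOrbit f ξ 1 = ξ := by
  simpa using π.qOrbit_apply ξ 1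

variable [IsTopologicalGroup Q]

theorem UnitaryRep.qOrbit_translate (hf : DenseRange f) (ξ : π.qVectors f) (g : G) (q : Q) :
    π.qOrbit f ξ (f g * q) = π.toHom g (π.qOrbit f ξ q) := by
  have : (fun q => π.qOrbit f ξ (f g * q)) = fun q => π.toHom g (π.qOrbit f ξ q) :=
    hf.equalizer ((π.continuous_qOrbit ξ).comp (continuous_const_mul _))
      ((π.toHom g).continuous.comp (π.continuous_qOrbit ξ)) (funext fun k => by
        simp only [Function.comp_apply, ← map_mul, qOrbit_apply]
        simp)
  exact congrFun this q

theorem UnitaryRep.qOrbit_mem (hf : DenseRange f) (ξ : π.qVectors f) (q : Q) :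
    π.qOrbit f ξ q ∈ π.qVectors f :=
  ⟨fun r => π.qOrbit f ξ (r * q), (π.continuous_qOrbit ξ).comp (continuous_mul_const q),
    fun g => (π.qOrbit_translate hf ξ g q).symm⟩

theorem UnitaryRep.qOrbit_mul (hf : DenseRange f) (ξ : π.qVectors f) (q r : Q) :
    π.qOrbit f ⟨π.qOrbit f ξ r, π.qOrbit_mem hf ξ r⟩ q = π.qOrbit f ξ (q * r) :=
  congrFun (π.qOrbit_unique hf _ (w := fun q => π.qOrbit f ξ (q * r))
    ((π.continuous_qOrbit ξ).comp (continuous_mul_const r))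
    fun g => π.qOrbit_translate hf ξ g r) q

/-- `π^Q`: the subrepresentation of `π` on the subspace of `Q`-vectors, viewed as a unitary
representation of `Q`. The element `q` acts by evaluating at `q` the extended orbital maps. -/
noncomputable def UnitaryRep.qRep (hf : DenseRange f) : UnitaryRep Q (π.qVectors f) where
  toHom :=
    { toFun := fun q =>
        { toFun := fun ξ => ⟨π.qOrbit f ξ q, π.qOrbit_mem hf ξ q⟩
          invFun := fun ξ => ⟨π.qOrbit f ξ q⁻¹, π.qOrbit_mem hf ξ q⁻¹⟩
          left_inv := fun ξ => Subtype.ext (by simp [π.qOrbit_mul hf, π.qOrbit_one])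
          right_inv := fun ξ => Subtype.ext (by simp [π.qOrbit_mul hf, π.qOrbit_one])
          map_add' := fun ξ η => Subtype.ext (congrFun (π.qOrbit_unique hf (ξ + η)
            ((π.continuous_qOrbit ξ).add (π.continuous_qOrbit η))
            fun g => by simp [π.qOrbit_apply]) q)
          map_smul' := fun c ξ => Subtype.ext (congrFun (π.qOrbit_unique hf (c • ξ)
            ((π.continuous_qOrbit ξ).const_smul c) fun g => by simp [π.qOrbit_apply]) q)
          norm_map' := fun ξ => π.norm_qOrbit hf ξ q }
      map_one' := by
        ext ξ
        exact π.qOrbit_one ξ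
      map_mul' := fun q r => by
        ext ξ
        exact (π.qOrbit_mul hf ξ q r).symm }
  continuous_orbit := fun ξ => (π.continuous_qOrbit ξ).subtype_mk _

/-- The defining property of `π^Q`: on `Q`-vectors, `f g` acts as `g` does. -/
theorem UnitaryRep.qRep_apply (hf : DenseRange f) (g : G) (ξ : π.qVectors f) :
    (((π.qRep hf).toHom (f g) ξ : π.qVectors f) : H) = π.toHom g ξ :=
  π.qOrbit_apply ξ g

end QVectors

/-! ### Resolutions and affine resolutions -/

/-- A morphism with dense image is a resolution if `1_G ≺ π` implies `1_Q ≺ π^Q`, for every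
unitary representation `π` of `G` on a Hilbert space. (Hilbert spaces in the universe of `G`
suffice: the vectors that witness `1_G ≺ π` can be taken in a subrepresentation generated by a
family of vectors indexed by the compact subsets of `G` and the positive integers.) -/
def IsResolution {G : Type u} {Q : Type v} [Group G] [TopologicalSpace G]
    [Group Q] [TopologicalSpace Q] [IsTopologicalGroup Q]
    (f : G →ₜ* Q) (hf : DenseRange f) : Prop :=
  ∀ (H : Type u) [NormedAddCommGroup H] [InnerProductSpace ℂ H] [CompleteSpace H]
    (π : UnitaryRep G H),
    π.AlmostHasInvariantVectors → (π.qRep hf).AlmostHasInvariantVectors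

/-- A morphism with dense image is an affine resolution if, for every (continuous) isometric
action `α` of `G` on an affine Hilbert space `P`, there is a non-empty `G`-invariant affine
subspace `V` such that the action of `G` on `V` factors through a (continuous, isometric) action
`β` of `Q` on `V`. (It is again enough to let the spaces range over the universe of `G`.) -/
def IsAffineResolution {G : Type u} {Q : Type v} [Group G] [TopologicalSpace G]
    [Group Q] [TopologicalSpace Q] (f : G →ₜ* Q) : Prop :=
  ∀ (H : Type u) [NormedAddCommGroup H] [InnerProductSpace ℝ H] [CompleteSpace H]
    (P : Type u) [MetricSpace P] [NormedAddTorsor H P] (α : G →* (P ≃ᵃⁱ[ℝ] P)),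
    (∀ x : P, Continuous fun g => α g x) →
    ∃ V : AffineSubspace ℝ P, (V : Set P).Nonempty ∧ (∀ (g : G), ∀ x ∈ V, α g x ∈ V) ∧
      ∃ β : Q →* (V ≃ᵢ V), (∀ x : V, Continuous fun q => β q x) ∧
        ∀ (g : G) (x : V), ((β (f g) x : V) : P) = α g x

end RelativeT

/-!
Write `1 - Re φ` for a normalized positive definite function `φ` and note that, up to a square root,
it controls `φ - 1`. Both implications between relative Property (T) and relative Property (FH) rest
on passing between `φ` and conditionally negative definite functions `ψ`. By Schoenberg's theorem
`exp (-tψ)` is positive definite, and it tends to `1` uniformly on compact sets as `t → 0`; so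
relative Property (T) bounds `ψ` on `X` (`RelativePropertyT.relativePropertyFH`). Conversely, on a
`σ`-compact group, functions `φ n` that tend to `1` rapidly on compact sets but not uniformly on `X`
give a locally uniformly convergent sum `∑ n (1 - Re φ n)` that is unbounded on `X`
(`exists_isCondNegDefinite_unbounded`).

To produce points whose orbital maps factor through `Q`, from bounds over a neighborhood of `1` in
`Q`, the action of `G` on a Hilbert space is regularized along `f` (`exists_orbit_factors`).
For a bump function `k` on `Q` and `q` in `Q`, let `c q` be the minimizer of the uniformly convex
functional `y ↦ sup_g k (q⁻¹ f g) (1 + ‖g x - y‖²)`. It depends continuously on `q`, because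
translation of `k` is uniformly continuous, and `g (c q) = c (f g q)` by uniqueness. Hence the
orbital map of `c 1` factors through `Q`, and `c 1` is close to `x` if `x` is moved little over the
support of `k`. Applied to an affine action, whose squared displacements are conditionally negative
definite, this turns relative Property (FH) into an affine resolution; the converse is the affine
Gelfand–Naimark–Segal construction. Applied to an almost invariant vector, it turns relative
Property (T) into a resolution.

For a resolution, positive definite functions that are close enough to `1` on a suitable compact
set are close to `1` on the preimage of a neighborhood of `1` in `Q` (`IsResolution.exists_re_ge`):
otherwise the components, orthogonal to the `Q`-vectors, of the corresponding cyclic vectors would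
be almost invariant in a representation without `Q`-vectors. Applied to indicator functions of open
subgroups, this shows that a set `X` with relatively compact image lies in an open `σ`-compact
subgroup `L`. If relative Property (T) failed for `X`, then `L` would carry a function `ψ` as above,
unbounded on `X`; but `exp (-tψ)`, extended by zero to `G`, is bounded below over a neighborhood of
`1` in `Q`, which bounds `ψ` there, and finitely many translates of its preimage cover `X`
(`IsResolution.relativePropertyT`).
-/

namespace RelativeT

/-! ### Positive semidefinite kernels -/

section Kernels

open Matrix
open scoped ComplexOrder

variable {S 𝕜 : Type*} [RCLike 𝕜]

/-- Positive semidefiniteness of a kernel on an arbitrary set, tested on finite families of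
points, with repetitions allowed. -/
theorem posSemidef_iff_forall_fin {M : Matrix S S 𝕜} :
    M.PosSemidef ↔ M.IsHermitian ∧ ∀ (n : ℕ) (g : Fin n → S) (c : Fin n → 𝕜),
      0 ≤ RCLike.re (∑ i, ∑ j, star (c i) * M (g i) (g j) * c j) := by
  refine and_congr_right fun hM => ⟨fun h n g c => ?_, fun h x => ?_⟩
  · have h1 := ((show M.PosSemidef from ⟨hM, h⟩).submatrix g).2 (Finsupp.equivFunOnFinite.symm c)
    have h2 : ((Finsupp.equivFunOnFinite.symm c).sum fun i xi =>
        (Finsupp.equivFunOnFinite.symm c).sum fun j xj => star xi * M.submatrix g g i j * xj) =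
        ∑ i, ∑ j, star (c i) * M (g i) (g j) * c j := by
      rw [Finsupp.sum_fintype _ _ (fun i => by simp)]
      refine Finset.sum_congr rfl fun i _ => ?_
      rw [Finsupp.sum_fintype _ _ (fun j => by simp)]
      rfl
    rw [h2] at h1
    exact (RCLike.nonneg_iff.1 h1).1
  · rw [RCLike.nonneg_iff]
    constructor
    · let e := x.support.equivFin.symm
      have key := h _ (fun i => (e i : S)) (fun i => x (e i))
      have h1 : ∀ F : S → 𝕜, ∑ i, F (e i : S) = ∑ s ∈ x.support, F s := fun F => by
        rw [e.sum_comp (fun s : x.support => F s), Finset.sum_coe_sort]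
      rw [h1 (fun t => ∑ j, star (x t) * M t (e j) * x (e j))] at key
      rw [Finset.sum_congr rfl fun t _ => h1 (fun s => star (x t) * M t s * x s)] at key
      exact key
    · rw [← RCLike.conj_eq_iff_im]
      simp only [Finsupp.sum, map_sum, map_mul]
      rw [Finset.sum_comm]
      refine Finset.sum_congr rfl fun i _ => Finset.sum_congr rfl fun j _ => ?_
      have := hM.apply i j
      simp only [RCLike.star_def] at this ⊢
      rw [this, RCLike.conj_conj]
      ring

/-- A real positive semidefinite kernel stays so when tested on complex coefficients. -/
theorem _root_.Matrix.PosSemidef.ofReal {M : Matrix S S ℝ} (hM : M.PosSemidef) :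
    (M.map ((↑) : ℝ → ℂ)).PosSemidef := by
  rw [posSemidef_iff_forall_fin] at hM ⊢
  obtain ⟨hs, hM⟩ := hM
  refine ⟨Matrix.IsHermitian.ext fun i j => ?_, fun n g c => ?_⟩
  · simpa using congrArg ((↑) : ℝ → ℂ) (hs.apply i j)
  · have h1 := add_nonneg (hM n g fun i => (c i).re) (hM n g fun i => (c i).im)
    refine h1.trans_eq ?_
    rw [map_sum, map_sum, map_sum, ← Finset.sum_add_distrib]
    refine Finset.sum_congr rfl fun i _ => ?_
    rw [map_sum, map_sum, map_sum, ← Finset.sum_add_distrib]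
    refine Finset.sum_congr rfl fun j _ => ?_
    simp

/-- The kernel `(s, t) ↦ a s * a t` of rank one. -/
theorem posSemidef_rankOne (a : S → ℝ) :
    (Matrix.of fun s t => a s * a t : Matrix S S ℝ).PosSemidef := by
  rw [posSemidef_iff_forall_fin]
  refine ⟨Matrix.IsHermitian.ext fun i j => by simp [mul_comm], fun n g c => ?_⟩
  have : ∑ i, ∑ j, star (c i) * (a (g i) * a (g j)) * c j = (∑ i, c i * a (g i)) ^ 2 := by
    rw [sq, Finset.sum_mul_sum]
    refine Finset.sum_congr rfl fun i _ => Finset.sum_congr rfl fun j _ => ?_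
    simp
    ring
  simp only [of_apply, RCLike.re_to_real]
  rw [this]
  positivity

/-- By the Schur product theorem, the entrywise exponential of a positive semidefinite kernel is
positive semidefinite: it is the limit of the entrywise powers of `1 + K / n`. -/
theorem _root_.Matrix.PosSemidef.map_exp {K : Matrix S S ℝ} (hK : K.PosSemidef) :
    (K.map Real.exp).PosSemidef := by
  have hpow : ∀ (A : Matrix S S ℝ), A.PosSemidef → ∀ n : ℕ,
      (A.map fun x => x ^ n).PosSemidef := by
    intro A hA n
    induction n with
    | zero => simpa using! posSemidef_rankOne (fun _ : S => (1 : ℝ))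
    | succ n ih => simpa only [pow_succ] using! ih.hadamard hA
  have hn : ∀ n : ℕ, (K.map fun x => (1 + x / n) ^ n).PosSemidef := fun n => by
    refine hpow (K.map fun x => 1 + x / n) ?_ n
    convert! (posSemidef_rankOne (fun _ : S => (1 : ℝ))).add
      (hK.smul (show (0 : ℝ) ≤ (n : ℝ)⁻¹ by positivity)) using 1
    ext i j
    simp [div_eq_inv_mul]
  rw [posSemidef_iff_forall_fin]
  refine ⟨Matrix.IsHermitian.ext fun i j => by simpa using hK.1.apply i j, fun n g c => ?_⟩
  refine ge_of_tendsto' (x := atTop) (f := fun m : ℕ => RCLike.re (∑ i, ∑ j,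
    star (c i) * (K.map fun x => (1 + x / m) ^ m) (g i) (g j) * c j)) ?_
    fun m => (posSemidef_iff_forall_fin.1 (hn m)).2 n g c
  simp only [RCLike.re_to_real, map_apply]
  exact tendsto_finsetSum _ fun i _ => tendsto_finsetSum _ fun j _ =>
    ((Real.tendsto_one_add_div_pow_exp _).const_mul _).mul_const _

end Kernels

/-! ### Positive definite and conditionally negative definite functions on groups -/

section Functions

open Matrix
open scoped ComplexOrder

variable {G : Type*} [Group G]

theorem isPositiveDefinite_iff_posSemidef {φ : G → ℂ} :
    IsPositiveDefinite φ ↔ (Matrix.of fun g h => φ (g⁻¹ * h) : Matrix G G ℂ).PosSemidef := by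
  have e : ∀ (n : ℕ) (g : Fin n → G) (c : Fin n → ℂ),
      ∑ i, ∑ j, star (c i) * star (star (c j)) * φ ((g i)⁻¹ * g j) =
        ∑ i, ∑ j, star (c i) * (Matrix.of fun g h => φ (g⁻¹ * h) : Matrix G G ℂ) (g i) (g j)
          * c j := fun n g c =>
    Finset.sum_congr rfl fun i _ => Finset.sum_congr rfl fun j _ => by
      rw [star_star, mul_right_comm, of_apply]
  rw [posSemidef_iff_forall_fin]
  refine and_congr ⟨fun h => Matrix.IsHermitian.ext fun a b => ?_, fun h g => ?_⟩
    (forall_congr' fun n => forall_congr' fun g => ⟨fun h c => ?_, fun h c => ?_⟩)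
  · rw [of_apply, of_apply, h (a⁻¹ * b), _root_.mul_inv_rev, inv_inv]
  · simpa using (h.apply 1 g).symm
  · rw [← e]
    exact h fun i => star (c i)
  · have := h fun i => star (c i)
    rw [← e] at this
    simpa only [star_star] using! this

theorem IsPositiveDefinite.norm_le_one {φ : G → ℂ} (h : IsPositiveDefinite φ) (h1 : φ 1 = 1)
    (g : G) : ‖φ g‖ ≤ 1 := by
  have := h.2 2 ![1, g] ![star (φ g), -1]
  have hs := h.1 g⁻¹
  rw [inv_inv] at hs
  simp [Fin.sum_univ_two, h1, hs, Complex.mul_re] at this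
  have h2 : ‖φ g‖ ^ 2 ≤ 1 := by
    rw [← Complex.normSq_eq_norm_sq, Complex.normSq_apply]
    linarith
  exact (sq_le_one_iff₀ (norm_nonneg _)).1 h2

/-- A normalized positive definite function is close to `1` where its real part is. -/
theorem IsPositiveDefinite.norm_sub_one_sq_le {φ : G → ℂ} (h : IsPositiveDefinite φ)
    (h1 : φ 1 = 1) (g : G) : ‖φ g - 1‖ ^ 2 ≤ 2 * (1 - (φ g).re) := by
  have h2 := h.norm_le_one h1 g
  have h3 : ‖φ g‖ ^ 2 ≤ 1 := pow_le_one₀ (norm_nonneg _) h2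
  rw [← Complex.normSq_eq_norm_sq, Complex.normSq_apply] at h3 ⊢
  simp
  linarith

theorem one_sub_re_le_norm (z : ℂ) : 1 - z.re ≤ ‖z - 1‖ := by
  rw [norm_sub_rev]
  simpa using Complex.re_le_norm (1 - z)

/-- The function `1 - Re φ` is conditionally negative definite. -/
theorem IsPositiveDefinite.isCondNegDefinite_one_sub_re {φ : G → ℂ} (h : IsPositiveDefinite φ)
    (h1 : φ 1 = 1) : IsCondNegDefinite fun g => 1 - (φ g).re := by
  refine ⟨by simp [h1], fun g => by simp [h.1 g], fun n g c hc => ?_⟩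
  have h2 := h.2 n g fun i => (c i : ℂ)
  have h3 : (∑ i, ∑ j, (c i : ℂ) * star (c j : ℂ) * φ ((g i)⁻¹ * g j)).re =
      ∑ i, ∑ j, c i * c j * (φ ((g i)⁻¹ * g j)).re := by
    simp only [Complex.re_sum]
    refine Finset.sum_congr rfl fun i _ => Finset.sum_congr rfl fun j _ => ?_
    simp
  have h4 : ∑ i, ∑ j, c i * c j = 0 := by simp [← Finset.mul_sum, hc]
  simp only [mul_sub, mul_one, Finset.sum_sub_distrib, h4]
  linarith [h3 ▸ h2]

variable {ψ : G → ℝ}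

/-- The squared distance from `g⁻¹` to `h` in the metric `√ψ(x⁻¹y)` is at most twice the sum of
the squared distances to `1`. -/
theorem IsCondNegDefinite.mul_le (h : IsCondNegDefinite ψ) (g k : G) :
    ψ (g * k) ≤ 2 * ψ g + 2 * ψ k := by
  have := h.2.2 3 ![g⁻¹, k, 1] ![1, 1, -2] (by
    rw [Fin.sum_univ_three]
    change (1 : ℝ) + 1 + -2 = 0
    norm_num)
  have h2 := h.2.1 (g * k)
  have h3 := h.2.1 g
  have h4 := h.2.1 k
  rw [_root_.mul_inv_rev] at h2
  simp [Fin.sum_univ_three, h.1, ← h2, ← h3, ← h4] at this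
  linarith

theorem IsCondNegDefinite.nonneg (h : IsCondNegDefinite ψ) (g : G) : 0 ≤ ψ g := by
  have := h.2.2 2 ![1, g] ![1, -1] (by simp)
  have h3 := h.2.1 g
  simp [Fin.sum_univ_two, h.1] at this
  linarith

/-- Schoenberg's kernel `(ψ g + ψ h - ψ (g⁻¹ h)) / 2`: the Gram matrix, with respect to the base
point `1`, of points at squared distances `ψ (g⁻¹ h)`. -/
theorem IsCondNegDefinite.posSemidef (h : IsCondNegDefinite ψ) :
    (Matrix.of fun g k => (ψ g + ψ k - ψ (g⁻¹ * k)) / 2 : Matrix G G ℝ).PosSemidef := by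
  rw [posSemidef_iff_forall_fin]
  refine ⟨Matrix.IsHermitian.ext fun a b => ?_, fun n g c => ?_⟩
  · have := h.2.1 (a⁻¹ * b)
    rw [_root_.mul_inv_rev, inv_inv] at this
    simp [this, add_comm]
  -- the base point receives the coefficient that makes the total weight vanish
  · have := h.2.2 (n + 1) (Fin.cons 1 g) (Fin.cons (-∑ i, c i) c) (by simp [Fin.sum_univ_succ])
    simp only [Fin.sum_univ_succ, Fin.cons_zero, Fin.cons_succ, inv_one, one_mul, mul_one,
      h.1, mul_zero, ← h.2.1, zero_add, Finset.sum_add_distrib] at this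
    simp only [RCLike.re_to_real, of_apply, star_trivial]
    have e : ∑ i, ∑ j, c i * ((ψ (g i) + ψ (g j) - ψ ((g i)⁻¹ * g j)) / 2) * c j =
        (∑ i, c i) * (∑ i, c i * ψ (g i)) -
          (∑ i, ∑ j, c i * c j * ψ ((g i)⁻¹ * g j)) / 2 := by
      have e1 : (∑ i, c i) * (∑ i, c i * ψ (g i)) =
          ∑ i, ∑ j, (c i * (c j * ψ (g j)) + c j * (c i * ψ (g i))) / 2 := by
        simp only [← Finset.sum_div, Finset.sum_add_distrib]
        rw [Finset.sum_comm (f := fun i j => c j * (c i * ψ (g i))), ← Finset.sum_mul_sum]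
        ring
      rw [e1, Finset.sum_div, ← Finset.sum_sub_distrib]
      refine Finset.sum_congr rfl fun i _ => ?_
      rw [Finset.sum_div, ← Finset.sum_sub_distrib]
      refine Finset.sum_congr rfl fun j _ => ?_
      ring
    rw [e]
    have e2 : ∀ s, ∑ x, -s * c x * ψ (g x) = -(s * ∑ i, c i * ψ (g i)) := fun s => by
      rw [Finset.mul_sum, ← Finset.sum_neg_distrib]
      exact Finset.sum_congr rfl fun j _ => by ring
    have e3 : ∀ s, ∑ x, c x * -s * ψ (g x) = -(s * ∑ i, c i * ψ (g i)) := fun s => by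
      rw [← e2]
      exact Finset.sum_congr rfl fun j _ => by ring
    rw [e2, e3] at this
    linarith

/-- **Schoenberg's theorem**: `exp (-tψ)` is positive definite. -/
theorem IsCondNegDefinite.isPositiveDefinite_exp (h : IsCondNegDefinite ψ) {t : ℝ} (ht : 0 ≤ t) :
    IsPositiveDefinite fun g => ((Real.exp (-(t * ψ g)) : ℝ) : ℂ) := by
  rw [isPositiveDefinite_iff_posSemidef]
  have h1 := (h.posSemidef.smul (show 0 ≤ 2 * t by positivity)).map_exp
  convert! ((posSemidef_rankOne fun g => Real.exp (-(t * ψ g))).hadamard h1).ofReal using 1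
  ext a b
  simp only [of_apply, map_apply, hadamard_apply, Matrix.smul_apply, smul_eq_mul, ← Real.exp_add]
  congr 2
  ring

end Functions

/-! ### Hilbert spaces generated by kernels -/

section GNS

open scoped ComplexOrder

variable {𝕜 : Type} [RCLike 𝕜]

/-- A positive semidefinite kernel is the Gram matrix of a total family in a Hilbert space, namely
of the point evaluations in its reproducing kernel Hilbert space. -/
theorem exists_total_family_of_posSemidef {S : Type u} {k : Matrix S S 𝕜} (hk : k.PosSemidef) :
    ∃ (H : Type u) (_ : NormedAddCommGroup H) (_ : InnerProductSpace 𝕜 H) (_ : CompleteSpace H)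
      (v : S → H), (∀ s t, inner 𝕜 (v s) (v t) = k s t) ∧
        (Submodule.span 𝕜 (Set.range v)).topologicalClosure = ⊤ := by
  let K : Matrix S S (𝕜 →L[𝕜] 𝕜) := Matrix.of fun s t => k s t • ContinuousLinearMap.id 𝕜 𝕜
  have hherm : K.IsHermitian := Matrix.IsHermitian.ext fun s t => by
    have := hk.1.apply s t
    simp only [K, Matrix.of_apply, star_smul, this]
    congr 1
    exact star_one _
  have hK : Fact K.PosSemidef := ⟨((RKHS.posSemidef_tfae (K := K)).out 0 2).2
    (And.intro hherm fun c => by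
      convert! (RCLike.nonneg_iff.1 (hk.2 c)).1 using 2
      simp only [Finsupp.sum]
      refine Finset.sum_congr rfl fun s _ => Finset.sum_congr rfl fun t _ => ?_
      have := hk.1.apply s t
      simp only [RCLike.star_def] at this
      simp [K, this]
      ring)⟩
  refine ⟨RKHS.OfKernel K, inferInstance, inferInstance, inferInstance,
    fun s => RKHS.kerFun (RKHS.OfKernel K) s 1, fun s t => ?_, ?_⟩
  · rw [RKHS.kerFun_inner, RKHS.kerFun_apply, RKHS.OfKernel.kernel_ofKernel]
    simp [K]
  · rw [← top_le_iff, ← RKHS.kerFun_dense (RKHS.OfKernel K)]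
    refine Submodule.topologicalClosure_mono (Submodule.span_le.2 ?_)
    rintro _ ⟨s, c, rfl⟩
    have : RKHS.kerFun (RKHS.OfKernel K) s c = c • RKHS.kerFun (RKHS.OfKernel K) s 1 := by
      rw [← map_smul, smul_eq_mul, mul_one]
    rw [this]
    exact Submodule.smul_mem _ _ (Submodule.subset_span ⟨s, rfl⟩)

variable {S H : Type*} [NormedAddCommGroup H] [InnerProductSpace 𝕜 H]

/-- Continuous linear maps that agree on a total family are equal. -/
theorem eq_of_eq_on_total {v : S → H}
    (hv : (Submodule.span 𝕜 (Set.range v)).topologicalClosure = ⊤) {A B : H →L[𝕜] H}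
    (h : ∀ s, A (v s) = B (v s)) : A = B :=
  ContinuousLinearMap.ext_on (Submodule.dense_iff_topologicalClosure_eq_top.2 hv)
    (by rintro _ ⟨s, rfl⟩; exact h s)

/-- Two total families with the same Gram matrix differ by a unitary operator. -/
theorem exists_linearIsometryEquiv_of_inner_eq [CompleteSpace H] {v w : S → H}
    (hv : (Submodule.span 𝕜 (Set.range v)).topologicalClosure = ⊤)
    (hw : (Submodule.span 𝕜 (Set.range w)).topologicalClosure = ⊤)
    (h : ∀ s t, inner 𝕜 (v s) (v t) = inner 𝕜 (w s) (w t)) :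
    ∃ A : H ≃ₗᵢ[𝕜] H, ∀ s, A (v s) = w s := by
  let V := Finsupp.linearCombination 𝕜 v
  let W := Finsupp.linearCombination 𝕜 w
  have hnorm : ∀ c, ‖W c‖ = ‖V c‖ := fun c => by
    rw [← sq_eq_sq₀ (norm_nonneg _) (norm_nonneg _), ← inner_self_eq_norm_sq (𝕜 := 𝕜),
      ← inner_self_eq_norm_sq (𝕜 := 𝕜)]
    simp only [V, W, Finsupp.linearCombination_apply, Finsupp.sum, sum_inner, inner_sum,
      inner_smul_left, inner_smul_right, h]
  have hVd : DenseRange V := by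
    rw [DenseRange, ← LinearMap.coe_range, Submodule.dense_iff_topologicalClosure_eq_top,
      Finsupp.range_linearCombination, hv]
  have hWd : DenseRange W := by
    rw [DenseRange, ← LinearMap.coe_range, Submodule.dense_iff_topologicalClosure_eq_top,
      Finsupp.range_linearCombination, hw]
  let A := LinearMap.extendOfNorm W V
  have hA : ∀ c, A (V c) = W c := fun c =>
    LinearMap.extendOfNorm_eq hVd ⟨1, fun c => by rw [one_mul, hnorm]⟩ c
  have hAn : ∀ x, ‖A x‖ = ‖x‖ := fun x => by
    have := DenseRange.equalizer hVd A.continuous.norm continuous_norm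
      (funext fun c => by simp [hA, hnorm])
    exact congrFun this x
  let A' : H →ₗᵢ[𝕜] H := ⟨A, hAn⟩
  have hsurj : Function.Surjective A' := by
    have h1 : IsClosed (Set.range A') := A'.isometry.isClosedEmbedding.isClosed_range
    have h2 : Dense (Set.range A') := hWd.mono (by
      rintro _ ⟨c, rfl⟩
      exact ⟨V c, hA c⟩)
    exact Set.range_eq_univ.1 (h1.closure_eq ▸ h2.closure_eq)
  refine ⟨LinearIsometryEquiv.ofSurjective A' hsurj, fun s => ?_⟩
  have h1 := hA (Finsupp.single s 1)
  simp only [V, W, Finsupp.linearCombination_single, one_smul] at h1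
  exact h1

/-- A family of vectors depends continuously on its parameter when its Gram matrix does. -/
theorem continuous_of_continuous_inner {X : Type*} [TopologicalSpace X] {v : X → H}
    (h : ∀ y, Continuous fun x => inner 𝕜 (v x) (v y))
    (h' : Continuous fun x => inner 𝕜 (v x) (v x)) : Continuous v := by
  rw [continuous_iff_continuousAt]
  intro y
  rw [ContinuousAt, tendsto_iff_norm_sub_tendsto_zero]
  have h1 : Tendsto (fun x => ‖v x - v y‖ ^ 2) (𝓝 y) (𝓝 0) := by
    have h2 : Continuous fun x => ‖v x - v y‖ ^ 2 := by
      have : (fun x => ‖v x - v y‖ ^ 2) = fun x => RCLike.re (inner 𝕜 (v x) (v x)) -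
          2 * RCLike.re (inner 𝕜 (v x) (v y)) + RCLike.re (inner 𝕜 (v y) (v y)) := by
        funext x
        rw [@norm_sub_sq 𝕜, inner_self_eq_norm_sq, inner_self_eq_norm_sq]
      rw [this]
      exact ((RCLike.continuous_re.comp h').sub
        ((RCLike.continuous_re.comp (h y)).const_mul 2)).add_const _
    simpa using h2.tendsto y
  simpa using h1.sqrt

/-- It suffices to check the continuity of the orbital maps on a total family. -/
theorem continuous_orbit_of_total {X : Type*} [TopologicalSpace X] {A : X → H ≃ₗᵢ[𝕜] H}
    {v : S → H} (hv : (Submodule.span 𝕜 (Set.range v)).topologicalClosure = ⊤)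
    (h : ∀ s, Continuous fun x => A x (v s)) (ξ : H) : Continuous fun x => A x ξ := by
  have hspan : ∀ η ∈ Submodule.span 𝕜 (Set.range v), Continuous fun x => A x η := by
    intro η hη
    induction hη using Submodule.span_induction with
    | mem η hη => obtain ⟨s, rfl⟩ := hη; exact h s
    | zero => simpa using continuous_const
    | add η ζ _ _ h1 h2 => simpa using! h1.add h2
    | smul c η _ h1 => simpa using! h1.const_smul c
  refine continuous_of_uniform_approx_of_continuous fun u hu => ?_
  obtain ⟨ε, hε, hu⟩ := Metric.mem_uniformity_dist.1 hu
  obtain ⟨η, hη, hd⟩ := Metric.mem_closure_iff.1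
    ((Submodule.dense_iff_topologicalClosure_eq_top.2 hv) ξ) ε hε
  exact ⟨_, hspan η hη, fun x => hu (by rwa [(A x).dist_map])⟩

end GNS

section Representations

open scoped ComplexOrder

variable {G : Type u} [Group G]

/-- The direct sum over a set `ι` of kernels attached to positive definite functions. -/
theorem posSemidef_sigma {ι : Type*} [DecidableEq ι] {φ : ι → G → ℂ}
    (hφ : ∀ i, IsPositiveDefinite (φ i)) :
    (Matrix.of fun s t => if s.1 = t.1 then φ s.1 (s.2⁻¹ * t.2) else 0 :
      Matrix (ι × G) (ι × G) ℂ).PosSemidef := by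
  rw [posSemidef_iff_forall_fin]
  refine ⟨Matrix.IsHermitian.ext fun s t => ?_, fun n g c => ?_⟩
  · by_cases h : s.1 = t.1
    · simp only [Matrix.of_apply, h, if_true]
      rw [(hφ t.1).1 (s.2⁻¹ * t.2), mul_inv_rev, inv_inv]
    · simp [Matrix.of_apply, h, Ne.symm h]
  -- finitely many points only meet finitely many blocks
  · let D : ι → Matrix (ι × G) (ι × G) ℂ := fun i => Matrix.of fun s t =>
      if s.1 = i ∧ t.1 = i then φ i (s.2⁻¹ * t.2) else 0
    have hD : ∀ i, (D i).PosSemidef := fun i => by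
      have h1 := (posSemidef_rankOne fun s : ι × G => if s.1 = i then 1 else 0).ofReal
      have h2 := (isPositiveDefinite_iff_posSemidef.1 (hφ i)).submatrix fun s : ι × G => s.2
      convert! h1.hadamard h2 using 1
      ext s t
      by_cases hs : s.1 = i <;> by_cases ht : t.1 = i <;> simp [D, hs, ht]
    have h1 := (posSemidef_iff_forall_fin.1 (Matrix.posSemidef_sum
      (Finset.univ.image fun a => (g a).1) fun i _ => hD i)).2 n g c
    refine h1.trans_eq (congrArg _ (Finset.sum_congr rfl fun a _ =>
      Finset.sum_congr rfl fun b _ => ?_))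
    congr 2
    rw [Matrix.sum_apply, Finset.sum_eq_single (g a).1]
    · simp [D, eq_comm]
    · intro i _ hi
      simp [D, hi.symm]
    · intro h
      exact absurd (Finset.mem_image_of_mem _ (Finset.mem_univ a)) h

variable [TopologicalSpace G] [IsTopologicalGroup G]

/-- The Gelfand–Naimark–Segal construction for a family of positive definite functions: they are
matrix coefficients of one unitary representation, the direct sum of the individual ones. -/
theorem exists_unitaryRep_of_isPositiveDefinite {ι : Type u} {φ : ι → G → ℂ}
    (hc : ∀ i, Continuous (φ i)) (hφ : ∀ i, IsPositiveDefinite (φ i)) :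
    ∃ (H : Type u) (_ : NormedAddCommGroup H) (_ : InnerProductSpace ℂ H) (_ : CompleteSpace H)
      (π : UnitaryRep G H) (ξ : ι → H), ∀ i g, inner ℂ (ξ i) (π.toHom g (ξ i)) = φ i g := by
  classical
  obtain ⟨H, _, _, _, v, hin, hv⟩ := exists_total_family_of_posSemidef (posSemidef_sigma hφ)
  simp only [Matrix.of_apply] at hin
  have hw : ∀ g : G, (Submodule.span ℂ
      (Set.range fun s : ι × G => v (s.1, g * s.2))).topologicalClosure = ⊤ := fun g => by
    have : (Set.range fun s : ι × G => v (s.1, g * s.2)) = Set.range v := by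
      refine Set.Subset.antisymm ?_ ?_
      · rintro _ ⟨s, rfl⟩
        exact ⟨_, rfl⟩
      · rintro _ ⟨s, rfl⟩
        exact ⟨(s.1, g⁻¹ * s.2), by simp⟩
    rw [this, hv]
  choose A hA using fun g => exists_linearIsometryEquiv_of_inner_eq hv (hw g) fun s t => by
    rw [hin, hin]
    simp [mul_assoc]
  have hone : A 1 = 1 := by
    have := eq_of_eq_on_total hv (A := (A 1 : H →L[ℂ] H)) (B := .id ℂ H) fun s => by simp [hA]
    ext x
    exact DFunLike.congr_fun this x
  have hmul : ∀ g h, A (g * h) = A g * A h := fun g h => by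
    have := eq_of_eq_on_total hv (A := (A (g * h) : H →L[ℂ] H))
      (B := (A g : H →L[ℂ] H).comp (A h : H →L[ℂ] H)) fun s => by simp [hA, mul_assoc]
    ext x
    exact DFunLike.congr_fun this x
  refine ⟨H, inferInstance, inferInstance, inferInstance,
    ⟨⟨⟨A, hone⟩, hmul⟩, continuous_orbit_of_total hv fun s => ?_⟩, fun i => v (i, 1),
    fun i g => ?_⟩
  · change Continuous fun g => A g (v s)
    simp only [hA]
    refine continuous_of_continuous_inner (𝕜 := ℂ) (fun g => ?_) ?_
    · simp only [hin, if_true]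
      exact (hc _).comp (by fun_prop)
    · simp only [hin, if_true, inv_mul_cancel]
      exact continuous_const
  · change inner ℂ (v (i, 1)) (A g (v (i, 1))) = _
    simp [hA, hin]

/-- The affine version of the Gelfand–Naimark–Segal construction: a conditionally negative
definite function is the squared displacement of a point in an isometric affine action. -/
theorem IsCondNegDefinite.exists_affine_action {ψ : G → ℝ} (hψ : IsCondNegDefinite ψ)
    (hc : Continuous ψ) :
    ∃ (H : Type u) (_ : NormedAddCommGroup H) (_ : InnerProductSpace ℝ H) (_ : CompleteSpace H)
      (α : G →* (H ≃ᵃⁱ[ℝ] H)), (∀ x, Continuous fun g => α g x) ∧ ∀ g, ‖α g 0‖ ^ 2 = ψ g := by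
  obtain ⟨H, _, _, _, b, hin, hb⟩ := exists_total_family_of_posSemidef hψ.posSemidef
  simp only [Matrix.of_apply] at hin
  have hnorm : ∀ g, ‖b g‖ ^ 2 = ψ g := fun g => by
    rw [← real_inner_self_eq_norm_sq, hin]
    simp [hψ.1]
  have hb1 : b 1 = 0 := by
    have := hnorm 1
    rw [hψ.1] at this
    simpa using this
  have hw : ∀ s : G,
      (Submodule.span ℝ (Set.range fun g => b (s * g) - b s)).topologicalClosure = ⊤ := fun s => by
    rw [← top_le_iff, ← hb]
    refine Submodule.topologicalClosure_mono (Submodule.span_le.2 ?_)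
    have hmem : ∀ g, b (s * g) - b s ∈ Submodule.span ℝ (Set.range fun g => b (s * g) - b s) :=
      fun g => Submodule.subset_span ⟨g, rfl⟩
    rintro _ ⟨t, rfl⟩
    have := Submodule.sub_mem _ (hmem (s⁻¹ * t)) (hmem s⁻¹)
    simpa [hb1] using this
  choose A hA using fun s => exists_linearIsometryEquiv_of_inner_eq hb (hw s) fun g h => by
    simp only [inner_sub_left, inner_sub_right, hin]
    simp [mul_assoc, hψ.1, ← hψ.2.1]
    ring
  have hone : A 1 = 1 := by
    have := eq_of_eq_on_total hb (A := (A 1 : H →L[ℝ] H)) (B := .id ℝ H)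
      fun s => by simp [hA, hb1]
    ext x
    exact DFunLike.congr_fun this x
  have hmul : ∀ g h, A (g * h) = A g * A h := fun g h => by
    have := eq_of_eq_on_total hb (A := (A (g * h) : H →L[ℝ] H))
      (B := (A g : H →L[ℝ] H).comp (A h : H →L[ℝ] H)) fun s => by simp [hA, mul_assoc]
    ext x
    exact DFunLike.congr_fun this x
  have hbc : Continuous b := by
    refine continuous_of_continuous_inner (𝕜 := ℝ) (fun g => ?_) ?_
    · simp only [hin]
      fun_prop
    · simp only [hin, inv_mul_cancel]
      fun_prop
  let α : G → (H ≃ᵃⁱ[ℝ] H) := fun s =>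
    (A s).toAffineIsometryEquiv.trans (AffineIsometryEquiv.constVAdd ℝ H (b s))
  have hα : ∀ s x, α s x = b s + A s x := fun s x => rfl
  refine ⟨H, inferInstance, inferInstance, inferInstance, ⟨⟨α, ?_⟩, fun g h => ?_⟩,
    fun x => ?_, fun g => ?_⟩
  · ext x
    simp [hα, hb1, hone]
  · ext x
    simp only [hα, hmul, hA, map_add, LinearIsometryEquiv.coe_mul,
      AffineIsometryEquiv.coe_mul, Function.comp_apply]
    abel
  · change Continuous fun g => α g x
    simp only [hα]
    refine hbc.add (continuous_orbit_of_total hb (fun g => ?_) x)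
    simp only [hA]
    exact (hbc.comp (by fun_prop)).sub hbc
  · change ‖α g 0‖ ^ 2 = ψ g
    simp [hα, hnorm]

end Representations

/-! ### Weighted circumcenters -/

section Circumcenter

/-- The Bruhat–Tits inequality: any two points have a midpoint that satisfies the
semi-parallelogram law. It holds in affine Hilbert spaces, real or complex. -/
def SemiParallelogramLaw (P : Type*) [MetricSpace P] : Prop :=
  ∀ y z : P, ∃ m : P, ∀ p : P,
    dist p m ^ 2 ≤ (dist p y ^ 2 + dist p z ^ 2) / 2 - dist y z ^ 2 / 4

theorem semiParallelogramLaw_of_innerProductSpace (𝕜 : Type*) {H P : Type*} [RCLike 𝕜]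
    [NormedAddCommGroup H] [InnerProductSpace 𝕜 H] [MetricSpace P] [NormedAddTorsor H P] :
    SemiParallelogramLaw P := by
  intro y z
  refine ⟨((1 / 2 : 𝕜) • (z -ᵥ y)) +ᵥ y, fun p => le_of_eq ?_⟩
  have h1 : p -ᵥ (((1 / 2 : 𝕜) • (z -ᵥ y)) +ᵥ y) = (1 / 2 : 𝕜) • ((p -ᵥ y) + (p -ᵥ z)) := by
    rw [vsub_vadd_eq_vsub_sub, ← vsub_sub_vsub_cancel_left z y p]
    module
  have h2 := parallelogram_law_with_norm 𝕜 (p -ᵥ y) (p -ᵥ z)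
  rw [vsub_sub_vsub_cancel_left, ← dist_eq_norm_vsub, dist_comm z y, ← dist_eq_norm_vsub H p y,
    ← dist_eq_norm_vsub H p z] at h2
  rw [dist_eq_norm_vsub H, h1, norm_smul, mul_pow]
  simp only [one_div, norm_inv, RCLike.norm_ofNat]
  linarith

variable {ι P : Type*} [MetricSpace P]

/-- A family of weights in `[0, 1]` with supremum `1`, on points `p i` that lie within distance `r`
of `o` whenever their weight is non-zero. -/
structure IsLocalizedWeight (k : ι → ℝ) (p : ι → P) (o : P) (r : ℝ) : Prop where
  nonneg : ∀ i, 0 ≤ k i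
  le_one : ∀ i, k i ≤ 1
  exists_gt : ∀ η < 1, ∃ i, η < k i
  dist_le : ∀ i, k i ≠ 0 → dist (p i) o ≤ r

/-- The functional whose minimizer is the weighted circumcenter. The summand `1` forces the
supremum to be attained, up to a small error, at points whose weight is bounded below, which makes
the functional uniformly convex on bounded sets. -/
noncomputable def weightedEnergy (k : ι → ℝ) (p : ι → P) (y : P) : ℝ :=
  ⨆ i, k i * (1 + dist (p i) y ^ 2)

namespace IsLocalizedWeight

variable {k k' : ι → ℝ} {p : ι → P} {o : P} {r : ℝ}

theorem dist_le_add (h : IsLocalizedWeight k p o r) (y : P) {i : ι} (hi : k i ≠ 0) :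
    dist (p i) y ≤ r + dist y o :=
  (dist_triangle _ o _).trans (by rw [dist_comm o]; gcongr; exact h.dist_le i hi)

theorem radius_nonneg (h : IsLocalizedWeight k p o r) : 0 ≤ r := by
  obtain ⟨i, hi⟩ := h.exists_gt 0 one_pos
  exact dist_nonneg.trans (h.dist_le i hi.ne')

theorem term_le (h : IsLocalizedWeight k p o r) (y : P) (i : ι) :
    k i * (1 + dist (p i) y ^ 2) ≤ 1 + (r + dist y o) ^ 2 := by
  by_cases hi : k i = 0
  · rw [hi, zero_mul]
    positivity
  · have h1 := h.dist_le_add y hi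
    have h2 : k i * (1 + dist (p i) y ^ 2) ≤ 1 * (1 + dist (p i) y ^ 2) := by
      gcongr
      exact h.le_one i
    refine h2.trans ?_
    rw [one_mul]
    gcongr

theorem term_le_energy (h : IsLocalizedWeight k p o r) (y : P) (i : ι) :
    k i * (1 + dist (p i) y ^ 2) ≤ weightedEnergy k p y :=
  le_ciSup (f := fun i => k i * (1 + dist (p i) y ^ 2))
    ⟨_, by rintro _ ⟨i, rfl⟩; exact h.term_le y i⟩ i

theorem energy_le (h : IsLocalizedWeight k p o r) {y : P} {C : ℝ}
    (hC : ∀ i, k i * (1 + dist (p i) y ^ 2) ≤ C) :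
    weightedEnergy k p y ≤ C :=
  have : Nonempty ι := ⟨(h.exists_gt 0 one_pos).choose⟩
  ciSup_le hC

theorem one_le_energy (h : IsLocalizedWeight k p o r) (y : P) : 1 ≤ weightedEnergy k p y := by
  refine le_of_forall_lt fun η hη => ?_
  obtain ⟨i, hi⟩ := h.exists_gt η hη
  refine hi.trans_le (le_trans ?_ (h.term_le_energy y i))
  nlinarith [h.nonneg i, mul_nonneg (h.nonneg i) (sq_nonneg (dist (p i) y))]

theorem energy_center_le (h : IsLocalizedWeight k p o r) : weightedEnergy k p o ≤ 1 + r ^ 2 := by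
  simpa using h.energy_le fun i => h.term_le o i

/-- Points of small energy are close to `o`. -/
theorem dist_le_of_energy_le (h : IsLocalizedWeight k p o r) {y : P} {s : ℝ} (hs : 0 ≤ s)
    (hy : weightedEnergy k p y ≤ 1 + s ^ 2) : dist y o ≤ r + s := by
  by_contra! hlt
  set t := dist y o - r
  have hst : s < t := by simp only [t]; linarith
  have hη : (1 + s ^ 2) / (1 + t ^ 2) < 1 := by
    rw [div_lt_one (by positivity)]
    gcongr
  obtain ⟨i, hi⟩ := h.exists_gt _ hη
  have hpos : 0 < k i := lt_of_le_of_lt (by positivity) hi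
  have h1 : t ≤ dist (p i) y := by
    have := dist_triangle_left y o (p i)
    have := h.dist_le i hpos.ne'
    simp only [t]
    linarith
  have h2 := h.term_le_energy y i
  rw [div_lt_iff₀ (by positivity)] at hi
  have h3 : k i * (1 + t ^ 2) ≤ k i * (1 + dist (p i) y ^ 2) := by
    have : 0 ≤ t := hs.trans hst.le
    gcongr
  linarith

/-- Uniform convexity of the energy: approximate minimizers are close to each other. -/
theorem dist_sq_le (h : IsLocalizedWeight k p o r) (hP : SemiParallelogramLaw P)
    {R e δ : ℝ} (he : ∀ m, e ≤ weightedEnergy k p m)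
    {y z : P} (hyR : dist y o ≤ R) (hzR : dist z o ≤ R)
    (hy : weightedEnergy k p y ≤ e + δ) (hz : weightedEnergy k p z ≤ e + δ) :
    dist y z ^ 2 ≤ 8 * δ * (1 + (r + R) ^ 2) := by
  obtain ⟨m, hm⟩ := hP y z
  have hR : 0 ≤ R := dist_nonneg.trans hyR
  have hr := h.radius_nonneg
  have hmo : dist m o ≤ R := by
    refine abs_le_of_sq_le_sq' ?_ hR |>.2
    have h1 := hm o
    rw [dist_comm o m, dist_comm o y, dist_comm o z] at h1
    have h2 : dist y o ^ 2 ≤ R ^ 2 := by gcongr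
    have h3 : dist z o ^ 2 ≤ R ^ 2 := by gcongr
    nlinarith [sq_nonneg (dist y z)]
  set M := 1 + (r + R) ^ 2
  have hM : 0 < M := by positivity
  have key : weightedEnergy k p m ≤ max (1 / 2) (e + δ - dist y z ^ 2 / (8 * M)) := by
    refine h.energy_le fun i => ?_
    by_cases hi : k i = 0
    · rw [hi, zero_mul]
      exact le_max_of_le_left (by norm_num)
    rcases le_total (k i) (1 / (2 * M)) with hk | hk
    · refine le_max_of_le_left ?_
      have h1 : 1 + dist (p i) m ^ 2 ≤ M := by
        have := h.dist_le_add m hi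
        simp only [M]
        gcongr
        linarith
      calc k i * (1 + dist (p i) m ^ 2) ≤ 1 / (2 * M) * M := by gcongr
        _ = 1 / 2 := by field_simp
    · refine le_max_of_le_right ?_
      have h1 := h.term_le_energy y i
      have h2 := h.term_le_energy z i
      have h3 : k i * dist (p i) m ^ 2 ≤
          k i * ((dist (p i) y ^ 2 + dist (p i) z ^ 2) / 2 - dist y z ^ 2 / 4) :=
        mul_le_mul_of_nonneg_left (hm (p i)) (h.nonneg i)
      have h4 : 1 / (2 * M) * dist y z ^ 2 ≤ k i * dist y z ^ 2 := by gcongr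
      have h5 : dist y z ^ 2 / (8 * M) = 1 / (2 * M) * dist y z ^ 2 / 4 := by
        field_simp
        ring
      rw [h5]
      linarith
  have h1 := h.one_le_energy m
  rcases le_max_iff.1 (le_refl (max (1 / 2) (e + δ - dist y z ^ 2 / (8 * M)))) with h2 | h2
  · linarith
  · have h3 := (he m).trans (key.trans h2)
    have h4 : dist y z ^ 2 / (8 * M) ≤ δ := by linarith
    rw [div_le_iff₀ (by positivity)] at h4
    linarith

theorem exists_minimizer [CompleteSpace P] (h : IsLocalizedWeight k p o r)
    (hP : SemiParallelogramLaw P) :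
    ∃ c, ∀ y, weightedEnergy k p c ≤ weightedEnergy k p y := by
  have : Nonempty P := ⟨o⟩
  set e := ⨅ y, weightedEnergy k p y
  have he : ∀ m, e ≤ weightedEnergy k p m := fun m =>
    ciInf_le ⟨1, by rintro _ ⟨y, rfl⟩; exact h.one_le_energy y⟩ m
  have hr := h.radius_nonneg
  choose s hs using fun n : ℕ => exists_lt_of_ciInf_lt
    (show e < e + 1 / ((n : ℝ) + 1) from lt_add_of_pos_right _ (by positivity))
  have hsR : ∀ n, dist (s n) o ≤ r + (r + 1) := fun n => by
    refine h.dist_le_of_energy_le (by positivity) ((hs n).le.trans ?_)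
    have h1 := (he o).trans h.energy_center_le
    have h2 : 1 / ((n : ℝ) + 1) ≤ 1 := by
      rw [div_le_one (by positivity)]
      linarith [n.cast_nonneg (α := ℝ)]
    nlinarith
  set M := 1 + (r + (r + (r + 1))) ^ 2
  have hlim := tendsto_one_div_add_atTop_nhds_zero_nat (𝕜 := ℝ)
  have hcauchy : CauchySeq s := by
    refine cauchySeq_of_le_tendsto_0 (fun N : ℕ => √(8 * (1 / ((N : ℝ) + 1)) * M)) ?_ ?_
    · intro n m N hn hm
      have hmono : ∀ j : ℕ, N ≤ j → weightedEnergy k p (s j) ≤ e + 1 / ((N : ℝ) + 1) :=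
        fun j hj => (hs j).le.trans (by gcongr)
      exact Real.le_sqrt_of_sq_le (h.dist_sq_le hP he (hsR n) (hsR m) (hmono n hn) (hmono m hm))
    · have := ((hlim.const_mul 8).mul_const M).sqrt
      simpa using this
  obtain ⟨c, hc⟩ := cauchySeq_tendsto_of_complete hcauchy
  refine ⟨c, fun y => le_trans (h.energy_le fun i => ?_) (he y)⟩
  have h1 : Tendsto (fun n => k i * (1 + dist (p i) (s n) ^ 2)) atTop
      (𝓝 (k i * (1 + dist (p i) c ^ 2))) :=
    (((tendsto_const_nhds.dist hc).pow 2).const_add 1).const_mul _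
  have h2 : Tendsto (fun n : ℕ => e + 1 / ((n : ℝ) + 1)) atTop (𝓝 e) := by
    simpa using hlim.const_add e
  exact le_of_tendsto_of_tendsto' h1 h2 fun n => (h.term_le_energy _ i).trans (hs n).le

theorem dist_minimizer_le (h : IsLocalizedWeight k p o r) {c : P}
    (hc : ∀ y, weightedEnergy k p c ≤ weightedEnergy k p y) :
    dist c o ≤ 2 * r := by
  have := h.dist_le_of_energy_le h.radius_nonneg ((hc o).trans h.energy_center_le)
  linarith

/-- The weighted circumcenter depends continuously on the weights. -/
theorem dist_minimizer_sq_le (h : IsLocalizedWeight k p o r) (hP : SemiParallelogramLaw P)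
    (h' : IsLocalizedWeight k' p o r)
    {η : ℝ} (hη : ∀ i, |k i - k' i| ≤ η) {c c' : P}
    (hc : ∀ y, weightedEnergy k p c ≤ weightedEnergy k p y)
    (hc' : ∀ y, weightedEnergy k' p c' ≤ weightedEnergy k' p y) :
    dist c c' ^ 2 ≤ 16 * η * (1 + (3 * r) ^ 2) ^ 2 := by
  have hr := h.radius_nonneg
  have compare : ∀ {k₁ k₂ : ι → ℝ}, IsLocalizedWeight k₁ p o r → IsLocalizedWeight k₂ p o r →
      (∀ i, |k₁ i - k₂ i| ≤ η) → ∀ y, dist y o ≤ 2 * r →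
      weightedEnergy k₁ p y ≤ weightedEnergy k₂ p y + η * (1 + (3 * r) ^ 2) := by
    intro k₁ k₂ h₁ h₂ h₁₂ y hy
    refine h₁.energy_le fun i => ?_
    have hη0 : 0 ≤ η := (abs_nonneg _).trans (h₁₂ i)
    by_cases hi : k₁ i = 0
    · rw [hi, zero_mul]
      have := h₂.one_le_energy y
      positivity
    · have h3 : dist (p i) y ≤ 3 * r := by linarith [h₁.dist_le_add y hi]
      have h4 := h₂.term_le_energy y i
      have h5 : (k₁ i - k₂ i) * (1 + dist (p i) y ^ 2) ≤ η * (1 + (3 * r) ^ 2) := by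
        have := (le_abs_self _).trans (h₁₂ i)
        gcongr
      linarith
  have hcR := h.dist_minimizer_le hc
  have hcR' := h'.dist_minimizer_le hc'
  have h1 := compare h h' hη c' hcR'
  have h2 := compare h' h (fun i => by rw [abs_sub_comm]; exact hη i) c hcR
  have hη0 : 0 ≤ η := (abs_nonneg _).trans (hη (h.exists_gt 0 one_pos).choose)
  have h3 := h.dist_sq_le hP hc hcR hcR' (δ := 2 * (η * (1 + (3 * r) ^ 2)))
    (le_add_of_nonneg_right (by positivity)) (by linarith [hc' c])
  refine h3.trans (le_of_eq ?_)
  ring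

theorem minimizer_unique (h : IsLocalizedWeight k p o r) (hP : SemiParallelogramLaw P) {c c' : P}
    (hc : ∀ y, weightedEnergy k p c ≤ weightedEnergy k p y)
    (hc' : ∀ y, weightedEnergy k p c' ≤ weightedEnergy k p y) : c = c' := by
  have := h.dist_minimizer_sq_le hP h (η := 0) (by simp) hc hc'
  have h2 : dist c c' ^ 2 = 0 := le_antisymm (by simpa using this) (sq_nonneg _)
  exact dist_eq_zero.1 (pow_eq_zero_iff (two_ne_zero) |>.1 h2)

end IsLocalizedWeight

end Circumcenter

/-! ### Orbits that factor through a dense morphism -/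

section Regularization

open scoped Pointwise

variable {Q : Type*} [Group Q] [TopologicalSpace Q] [IsTopologicalGroup Q]

/-- Left translation of a compactly supported function is continuous in the uniform norm. -/
theorem eventually_abs_translate_sub_le [LocallyCompactSpace Q] {k : Q → ℝ} (hk : Continuous k)
    (hs : HasCompactSupport k) (q₀ : Q) {η : ℝ} (hη : 0 < η) :
    ∀ᶠ q in 𝓝 q₀, ∀ u, |k (q⁻¹ * u) - k (q₀⁻¹ * u)| ≤ η := by
  obtain ⟨D, hD, hD₀⟩ := exists_compact_mem_nhds q₀
  have hK : IsCompact (D * tsupport k) := hD.mul hs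
  have hon : ∀ᶠ q in 𝓝 q₀, ∀ u ∈ D * tsupport k, |k (q⁻¹ * u) - k (q₀⁻¹ * u)| ≤ η := by
    refine hK.eventually_forall_of_forall_eventually fun u _ => ?_
    have hcont : Continuous fun z : Q × Q => |k (z.1⁻¹ * z.2) - k (q₀⁻¹ * z.2)| := by fun_prop
    have hlt := hcont.tendsto (q₀, u) |>.eventually_lt_const (u := η) (by simpa using hη)
    exact hlt.mono fun z hz => hz.le
  filter_upwards [hon, hD₀] with q hq hqD u
  by_cases hu : u ∈ D * tsupport k
  · exact hq u hu
  · have hzero : ∀ d ∈ D, k (d⁻¹ * u) = 0 := fun d hd => by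
      by_contra hne
      exact hu ⟨d, hd, d⁻¹ * u, subset_tsupport k hne, by simp⟩
    rw [hzero q hqD, hzero q₀ (mem_of_mem_nhds hD₀)]
    simpa using hη.le

variable {G P : Type*} [Group G] [MetricSpace P] [CompleteSpace P]

/-- If an orbital map is bounded over a neighborhood of `1` in `Q`, then there is a point nearby
whose orbital map factors continuously through `Q`: the circumcenter of the orbit weighted by a bump
function on `Q`. Translating the bump function moves the circumcenter continuously, and translating
it by `f g` moves the circumcenter by `g`. -/
theorem exists_orbit_factors [LocallyCompactSpace Q] [T2Space Q] (hP : SemiParallelogramLaw P)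
    (f : G →* Q) (hf : DenseRange f) (α : G →* (P ≃ᵢ P)) (x : P) (r : ℝ) {C : Set Q}
    (hC : C ∈ 𝓝 1) (hr : ∀ g, f g ∈ C → dist (α g x) x ≤ r) :
    ∃ y, dist y x ≤ 2 * r ∧ ∃ w : Q → P, Continuous w ∧ ∀ g, α g y = w (f g) := by
  obtain ⟨O, hO, hO1, hOC⟩ := exists_open_nhds_one_mul_subset hC
  obtain ⟨k, hk1, hk0, hks, hk01⟩ := exists_continuous_one_zero_of_isCompact
    (isCompact_singleton (x := (1 : Q))) hO.isClosed_compl (by simpa using hO1)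
  have hkO : ∀ u, k u ≠ 0 → u ∈ O := fun u hu => by
    by_contra h
    exact hu (hk0 h)
  let wt : Q → G → ℝ := fun q g => k (q⁻¹ * f g)
  let p : G → P := fun g => α g x
  have hwt : ∀ (h : G) (q : Q), (f h)⁻¹ * q ∈ O → IsLocalizedWeight (wt q) p (α h x) r := by
    intro h q hq
    refine ⟨fun g => (hk01 _).1, fun g => (hk01 _).2, fun η hη => ?_, fun g hg => ?_⟩
    · refine hf.exists_mem_open (s := {u | η < k (q⁻¹ * u)})
        (isOpen_lt continuous_const (by fun_prop)) ⟨q, ?_⟩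
      simpa [hk1 (Set.mem_singleton 1)] using hη
    · have h1 : f (h⁻¹ * g) ∈ C := hOC ⟨_, hq, _, hkO _ hg, by simp [mul_assoc]⟩
      have h2 := hr _ h1
      rw [← (α h).dist_eq, ← IsometryEquiv.mul_apply, ← map_mul, mul_inv_cancel_left] at h2
      exact h2
  have hex : ∀ q : Q, ∃ h : G, (f h)⁻¹ * q ∈ O := fun q =>
    hf.exists_mem_open (s := {u | u⁻¹ * q ∈ O}) (hO.preimage (by fun_prop)) ⟨q, by simpa using hO1⟩
  choose w hw using fun q : Q => (hwt _ q (hex q).choose_spec).exists_minimizer hP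
  have htrans : ∀ (h : G) (q : Q) (y : P),
      weightedEnergy (wt (f h * q)) p (α h y) = weightedEnergy (wt q) p y := by
    intro h q y
    rw [weightedEnergy, weightedEnergy, ← (Equiv.mulLeft h).iSup_comp]
    congr 1
    funext g
    simp only [wt, p, Equiv.coe_mulLeft, map_mul, IsometryEquiv.mul_apply, (α h).dist_eq,
      mul_inv_rev]
    congr 2
    group
  have hequiv : ∀ (h : G) (q : Q), α h (w q) = w (f h * q) := by
    intro h q
    refine (hwt _ _ (hex (f h * q)).choose_spec).minimizer_unique hP (fun y => ?_) (hw _)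
    have h1 := htrans h q ((α h).symm y)
    rw [(α h).apply_symm_apply] at h1
    rw [htrans, h1]
    exact hw q _
  refine ⟨w 1, ?_, w, ?_, fun g => by rw [hequiv, mul_one]⟩
  · have := (hwt 1 1 (by simpa using hO1)).dist_minimizer_le (hw 1)
    simpa using this
  rw [continuous_iff_continuousAt]
  intro q₀
  obtain ⟨h, hh⟩ := hex q₀
  rw [ContinuousAt, Metric.tendsto_nhds]
  intro ε hε
  set M := 16 * (1 + (3 * r) ^ 2) ^ 2
  have hM : 0 < M := by positivity
  filter_upwards [eventually_abs_translate_sub_le k.continuous hks q₀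
      (η := ε ^ 2 / (2 * M)) (by positivity),
    (hO.preimage (continuous_const_mul (f h)⁻¹)).mem_nhds hh] with q hq hqO
  have h1 := (hwt h q hqO).dist_minimizer_sq_le hP (hwt h q₀ hh) (fun g => hq (f g)) (hw q) (hw q₀)
  have h2 : 16 * (ε ^ 2 / (2 * M)) * (1 + (3 * r) ^ 2) ^ 2 = ε ^ 2 / 2 := by
    rw [show 16 * (ε ^ 2 / (2 * M)) * (1 + (3 * r) ^ 2) ^ 2 = ε ^ 2 / (2 * M) * M by
      simp only [M]; ring]
    field_simp
  rw [h2] at h1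
  exact lt_of_pow_lt_pow_left₀ 2 hε.le (h1.trans_lt (half_lt_self (by positivity)))

end Regularization

/-! ### Extension by zero from an open subgroup -/

section Extension

open scoped ComplexOrder

variable {G : Type*} [Group G] {L : Subgroup G}

open scoped Classical in
/-- The extension by zero of a function on a subgroup. -/
noncomputable def extendByZero (φ : L → ℂ) (g : G) : ℂ :=
  if h : g ∈ L then φ ⟨g, h⟩ else 0

theorem extendByZero_of_mem (φ : L → ℂ) {g : G} (h : g ∈ L) : extendByZero φ g = φ ⟨g, h⟩ :=
  dif_pos h

theorem extendByZero_of_notMem (φ : L → ℂ) {g : G} (h : g ∉ L) : extendByZero φ g = 0 :=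
  dif_neg h

/-- The kernel of the extension is the Schur product of the kernel of the partition of `G` into left
cosets of `L` with a kernel that is pulled back to `L` along a choice of coset representatives. -/
theorem IsPositiveDefinite.extendByZero {φ : L → ℂ} (hφ : IsPositiveDefinite φ) :
    IsPositiveDefinite (extendByZero φ) := by
  classical
  have hl : ∀ g : G, (Quotient.out (g : G ⧸ L))⁻¹ * g ∈ L := fun g =>
    QuotientGroup.eq.1 (QuotientGroup.out_eq' (g : G ⧸ L))
  let l : G → L := fun g => ⟨_, hl g⟩
  rw [isPositiveDefinite_iff_posSemidef] at hφ ⊢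
  have h1 : (1 : Matrix (G ⧸ L) (G ⧸ L) ℂ).PosSemidef := .one
  convert! (h1.submatrix fun g : G => (g : G ⧸ L)).hadamard (hφ.submatrix l) using 1
  ext g h
  by_cases hgh : g⁻¹ * h ∈ L
  · have he : (g : G ⧸ L) = h := QuotientGroup.eq.2 hgh
    have hlgh : (l g)⁻¹ * l h = ⟨g⁻¹ * h, hgh⟩ := by
      ext
      simp [l, he, mul_assoc]
    simp [Matrix.one_apply, he, hlgh, extendByZero_of_mem _ hgh]
  · have he : (g : G ⧸ L) ≠ h := fun h => hgh (QuotientGroup.eq.1 h)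
    simp [he, extendByZero_of_notMem _ hgh]

theorem continuous_extendByZero [TopologicalSpace G] [IsTopologicalGroup G]
    (hL : IsOpen (L : Set G)) {φ : L → ℂ} (hφ : Continuous φ) :
    Continuous (extendByZero φ) := by
  rw [continuous_iff_continuousAt]
  intro g
  by_cases hg : g ∈ L
  · have h1 : ContinuousAt (extendByZero φ ∘ ((↑) : L → G)) ⟨g, hg⟩ := by
      have : extendByZero φ ∘ ((↑) : L → G) = φ := funext fun x => extendByZero_of_mem φ x.2
      rw [this]
      exact hφ.continuousAt
    exact (hL.isOpenEmbedding_subtypeVal.continuousAt_iff (x := ⟨g, hg⟩)).1 h1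
  · have h0 : ContinuousAt (fun _ : G => (0 : ℂ)) g := continuousAt_const
    refine h0.congr ?_
    filter_upwards [(L.isClosed_of_isOpen hL).isOpen_compl.mem_nhds hg] with x hx
    exact (extendByZero_of_notMem φ hx).symm

end Extension

/-! ### Compactly generated open subgroups -/

section Subgroups

open scoped Pointwise

variable {G : Type*} [Group G] [TopologicalSpace G] [IsTopologicalGroup G]

theorem isSigmaCompact_subgroup_closure {A : Set G} (hA : IsCompact A) :
    IsSigmaCompact (Subgroup.closure A : Set G) := by
  set B := A ∪ A⁻¹
  have hB : IsCompact B := hA.union hA.inv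
  have hBinv : B⁻¹ = B := by simp [B, Set.union_comm]
  have hpow : ∀ n : ℕ, IsCompact (B ^ n) := fun n => by
    induction n with
    | zero => simp
    | succ n ih => simpa only [pow_succ] using ih.mul hB
  have hsub : ∀ n : ℕ, B ^ n ⊆ (Subgroup.closure A : Set G) := fun n => by
    induction n with
    | zero => simp
    | succ n ih =>
      rw [pow_succ]
      rintro _ ⟨x, hx, y, hy, rfl⟩
      refine Subgroup.mul_mem _ (ih hx) ?_
      rcases hy with hy | hy
      · exact Subgroup.subset_closure hy
      · exact (Subgroup.inv_mem_iff _).1 (Subgroup.subset_closure hy)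
  have heq : (Subgroup.closure A : Set G) = ⋃ n : ℕ, B ^ n := by
    refine Set.Subset.antisymm (fun x hx => ?_) (Set.iUnion_subset hsub)
    simp only [Set.mem_iUnion]
    induction hx using Subgroup.closure_induction with
    | mem x hx => exact ⟨1, by simpa [B] using Or.inl hx⟩
    | one => exact ⟨0, by simp⟩
    | mul x y _ _ hx hy =>
      obtain ⟨n, hn⟩ := hx
      obtain ⟨m, hm⟩ := hy
      exact ⟨n + m, by rw [pow_add]; exact Set.mul_mem_mul hn hm⟩
    | inv x _ hx =>
      obtain ⟨n, hn⟩ := hx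
      exact ⟨n, by rwa [← hBinv, inv_pow, Set.inv_mem_inv]⟩
  rw [heq]
  exact isSigmaCompact_iUnion_of_isCompact _ hpow

theorem isOpen_subgroup_closure {A : Set G} (hA : A ∈ 𝓝 1) :
    IsOpen (Subgroup.closure A : Set G) :=
  Subgroup.isOpen_of_mem_nhds _ (mem_of_superset hA Subgroup.subset_closure)

end Subgroups

/-! ### Sums of conditionally negative definite functions -/

section Series

variable {G : Type*} [Group G]

theorem IsCondNegDefinite.const_mul {ψ : G → ℝ} (h : IsCondNegDefinite ψ) {a : ℝ} (ha : 0 ≤ a) :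
    IsCondNegDefinite fun g => a * ψ g := by
  refine ⟨by simp [h.1], fun g => congrArg (a * ·) (h.2.1 g), fun n g c hc => ?_⟩
  have h1 := mul_nonpos_of_nonneg_of_nonpos ha (h.2.2 n g c hc)
  simp only [Finset.mul_sum] at h1
  refine le_of_eq_of_le ?_ h1
  exact Finset.sum_congr rfl fun i _ => Finset.sum_congr rfl fun j _ => by ring

theorem isCondNegDefinite_tsum {ψ : ℕ → G → ℝ} (h : ∀ n, IsCondNegDefinite (ψ n))
    (hs : ∀ g, Summable fun n => ψ n g) : IsCondNegDefinite fun g => ∑' n, ψ n g := by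
  refine ⟨by simp [fun n => (h n).1], fun g => tsum_congr fun n => (h n).2.1 g,
    fun n g c hc => ?_⟩
  have h1 : HasSum (fun m => ∑ i, ∑ j, c i * c j * ψ m ((g i)⁻¹ * g j))
      (∑ i, ∑ j, c i * c j * ∑' m, ψ m ((g i)⁻¹ * g j)) :=
    hasSum_sum fun i _ => hasSum_sum fun j _ => (hs _).hasSum.mul_left _
  exact hasSum_le (fun m => (h m).2.2 n g c hc) h1 hasSum_zero

variable [TopologicalSpace G] [LocallyCompactSpace G] [SigmaCompactSpace G]

/-- If positive definite functions close to `1` on large compact sets need not be close to `1` on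
`X`, then on a `σ`-compact group a sum of suitable multiples of the functions `1 - Re φ` converges
locally uniformly and is unbounded on `X`. -/
theorem exists_isCondNegDefinite_unbounded {X : Set G} {ε : ℝ} (hε : 0 < ε)
    (H : ∀ K : Set G, IsCompact K → ∀ δ : ℝ, 0 < δ → ∃ φ : G → ℂ, Continuous φ ∧
      IsPositiveDefinite φ ∧ φ 1 = 1 ∧ (∀ g ∈ K, 1 - (φ g).re ≤ δ) ∧
        ∃ x ∈ X, ε < 1 - (φ x).re) :
    ∃ ψ : G → ℝ, Continuous ψ ∧ IsCondNegDefinite ψ ∧ ∀ C, ∃ x ∈ X, C < ψ x := by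
  let K : CompactExhaustion G := default
  -- even after multiplication by `n`, the function `1 - Re (φ n)` is at most `2⁻ⁿ` on `K n`
  choose φ hc hp h1 hK x hxX hx using fun n : ℕ =>
    H (K n) (K.isCompact n) ((1 / 2) ^ n / (n + 1)) (by positivity)
  let ψ : ℕ → G → ℝ := fun n g => n * (1 - (φ n g).re)
  have hψ : ∀ n, IsCondNegDefinite (ψ n) := fun n =>
    ((hp n).isCondNegDefinite_one_sub_re (h1 n)).const_mul n.cast_nonneg
  have hψc : ∀ n, Continuous (ψ n) := fun n =>
    continuous_const.mul (continuous_const.sub (Complex.continuous_re.comp (hc n)))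
  let b : ℕ → ℕ → ℝ := fun m n => (1 / 2) ^ n + if n < m then 2 * (n : ℝ) else 0
  have hb : ∀ m, Summable (b m) := fun m => by
    refine (summable_geometric_of_lt_one (by norm_num) (by norm_num)).add
      (summable_of_ne_finset_zero (s := Finset.range m) fun n hn => ?_)
    simp only [Finset.mem_range] at hn
    simp [hn]
  have hbound : ∀ m n, ∀ g ∈ K m, ‖ψ n g‖ ≤ b m n := fun m n g hg => by
    rw [Real.norm_of_nonneg ((hψ n).nonneg g)]
    by_cases hnm : n < m
    · have hre : -1 ≤ (φ n g).re :=
        (abs_le.1 ((Complex.abs_re_le_norm _).trans ((hp n).norm_le_one (h1 n) g))).1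
      have h2 : ψ n g ≤ n * 2 := mul_le_mul_of_nonneg_left (by linarith) n.cast_nonneg
      have h3 : (0 : ℝ) ≤ (1 / 2) ^ n := by positivity
      simp only [b, hnm, if_true]
      linarith
    · have h2 := hK n g (K.subset (not_lt.1 hnm) hg)
      have h3 : ψ n g ≤ n * ((1 / 2) ^ n / (n + 1)) := mul_le_mul_of_nonneg_left h2 n.cast_nonneg
      have h4 : n * ((1 / 2) ^ n / ((n : ℝ) + 1)) ≤ (1 / 2) ^ n := by
        rw [mul_div_assoc', div_le_iff₀ (by positivity)]
        have : (0 : ℝ) ≤ (1 / 2) ^ n := by positivity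
        nlinarith
      simp only [b, hnm, if_false, add_zero]
      linarith
  have hsum : ∀ g, Summable fun n => ψ n g := fun g => by
    obtain ⟨m, hm⟩ := K.exists_mem g
    exact (hb m).of_norm_bounded fun n => hbound m n g hm
  refine ⟨fun g => ∑' n, ψ n g, ?_, isCondNegDefinite_tsum hψ hsum, fun C => ?_⟩
  · rw [continuous_iff_continuousAt]
    intro g
    obtain ⟨m, hm⟩ := K.exists_mem_nhds g
    exact (continuousOn_tsum (fun n => (hψc n).continuousOn) (hb m)
      fun n g hg => hbound m n g hg).continuousAt hm
  · obtain ⟨n, hn⟩ := exists_nat_gt (|C| / ε)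
    refine ⟨x n, hxX n, ?_⟩
    rw [div_lt_iff₀ hε] at hn
    have h2 : n * ε ≤ ψ n (x n) := mul_le_mul_of_nonneg_left (hx n).le n.cast_nonneg
    have h3 : ψ n (x n) ≤ ∑' m, ψ m (x n) :=
      (hsum (x n)).le_tsum n fun m _ => (hψ m).nonneg _
    linarith [le_abs_self C]

end Series

/-! ### Relative properties (T) and (FH) -/

section Relative

theorem exists_exp_close {Y : Type*} [TopologicalSpace Y] {ψ : Y → ℝ} (hc : Continuous ψ)
    {K : Set Y} (hK : IsCompact K) {δ : ℝ} (hδ : 0 < δ) :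
    ∃ t : ℝ, 0 < t ∧ ∀ g ∈ K, 1 - Real.exp (-(t * ψ g)) ≤ δ := by
  obtain ⟨M, hM⟩ := hK.bddAbove_image hc.continuousOn
  refine ⟨δ / (|M| + 1), by positivity, fun g hg => ?_⟩
  have h1 : ψ g ≤ |M| + 1 := by
    linarith [hM (Set.mem_image_of_mem ψ hg), le_abs_self M]
  have h2 : δ / (|M| + 1) * ψ g ≤ δ := by
    calc δ / (|M| + 1) * ψ g ≤ δ / (|M| + 1) * (|M| + 1) := by gcongr
      _ = δ := by field_simp
  linarith [Real.one_sub_le_exp_neg (δ / (|M| + 1) * ψ g)]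

variable {G : Type u} [Group G] [TopologicalSpace G]

/-- Relative Property (T) in terms of compact sets and positive numbers in place of nets. -/
theorem relativePropertyT_iff {X : Set G} :
    RelativePropertyT G X ↔ ∀ ε : ℝ, 0 < ε → ∃ K : Set G, IsCompact K ∧ ∃ δ : ℝ, 0 < δ ∧
      ∀ φ : G → ℂ, Continuous φ → IsPositiveDefinite φ → φ 1 = 1 →
        (∀ g ∈ K, 1 - (φ g).re ≤ δ) → ∀ x ∈ X, 1 - (φ x).re ≤ ε := by
  constructor
  · intro h ε hε
    by_contra! hcon
    choose φ hc hp h1 hK x hxX hx using fun i : TopologicalSpace.Compacts G × ℕ =>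
      hcon i.1 i.1.isCompact (1 / ((i.2 : ℝ) + 1)) (by positivity)
    have hX := h (TopologicalSpace.Compacts G × ℕ) φ (fun i => ⟨hc i, hp i, h1 i⟩)
      fun K hKc => Metric.tendstoUniformlyOn_iff.2 fun η hη => by
        obtain ⟨n, hn⟩ := exists_nat_one_div_lt (show 0 < η ^ 2 / 2 by positivity)
        filter_upwards [eventually_ge_atTop ((⟨K, hKc⟩, n) : TopologicalSpace.Compacts G × ℕ)]
          with i hi g hg
        have h2 := hK i g (hi.1 hg)
        have h3 := (hp i).norm_sub_one_sq_le (h1 i) g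
        have h4 : 1 / ((i.2 : ℝ) + 1) ≤ 1 / ((n : ℝ) + 1) := by
          have : (n : ℝ) ≤ i.2 := Nat.cast_le.2 hi.2
          gcongr
        rw [dist_comm, dist_eq_norm]
        exact lt_of_pow_lt_pow_left₀ 2 hη.le (by linarith)
    obtain ⟨i, hi⟩ := (Metric.tendstoUniformlyOn_iff.1 hX ε hε).exists
    have h2 := hi (x i) (hxX i)
    rw [dist_comm, dist_eq_norm] at h2
    linarith [hx i, one_sub_re_le_norm (φ i (x i))]
  · intro h ι _ _ _ φ hφ hlim
    rw [Metric.tendstoUniformlyOn_iff]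
    intro ε hε
    obtain ⟨K, hK, δ, hδ, hX⟩ := h (ε ^ 2 / 4) (by positivity)
    filter_upwards [Metric.tendstoUniformlyOn_iff.1 (hlim K hK) δ hδ] with i hi x hx
    obtain ⟨hc, hp, h1⟩ := hφ i
    have h2 := hX (φ i) hc hp h1 (fun g hg => (one_sub_re_le_norm _).trans (by
      have := hi g hg
      rw [dist_comm, dist_eq_norm] at this
      exact this.le)) x hx
    have h3 := hp.norm_sub_one_sq_le h1 x
    rw [dist_comm, dist_eq_norm]
    exact lt_of_pow_lt_pow_left₀ 2 hε.le (by nlinarith)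

theorem le_of_one_half_le_exp {t a : ℝ} (ht : 0 < t) (h : 1 / 2 ≤ Real.exp (-(t * a))) :
    a ≤ Real.log 2 / t := by
  rw [le_div_iff₀ ht]
  have := Real.log_le_log (by norm_num) h
  rw [Real.log_exp, one_div, Real.log_inv] at this
  linarith

theorem relativePropertyFH_of_bound {X : Set G}
    (h : ∀ ψ : G → ℝ, Continuous ψ → IsCondNegDefinite ψ → ∃ C, ∀ x ∈ X, ψ x ≤ C) :
    RelativePropertyFH G X := fun ψ hc hψ => by
  obtain ⟨C, hC⟩ := h ψ hc hψ
  refine (Metric.isBounded_Icc 0 C).subset ?_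
  rintro _ ⟨x, hx, rfl⟩
  exact ⟨hψ.nonneg x, hC x hx⟩

theorem RelativePropertyFH.exists_bound {X : Set G} (h : RelativePropertyFH G X) {ψ : G → ℝ}
    (hc : Continuous ψ) (hψ : IsCondNegDefinite ψ) : ∃ C, ∀ x ∈ X, ψ x ≤ C := by
  obtain ⟨C, hC⟩ := (h ψ hc hψ).bddAbove
  exact ⟨C, fun x hx => hC (Set.mem_image_of_mem ψ hx)⟩

/-- Relative Property (T) implies relative Property (FH), by Schoenberg's theorem. -/
theorem RelativePropertyT.relativePropertyFH {X : Set G} (h : RelativePropertyT G X) :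
    RelativePropertyFH G X := by
  refine relativePropertyFH_of_bound fun ψ hc hψ => ?_
  obtain ⟨K, hK, δ, hδ, hX⟩ := relativePropertyT_iff.1 h (1 / 2) (by norm_num)
  obtain ⟨t, ht, hKt⟩ := exists_exp_close hc hK hδ
  refine ⟨Real.log 2 / t, fun x hx => le_of_one_half_le_exp ht ?_⟩
  have := hX _ (by fun_prop) (hψ.isPositiveDefinite_exp ht.le) (by simp [hψ.1])
    (fun g hg => by rw [Complex.ofReal_re]; exact hKt g hg) x hx
  rw [Complex.ofReal_re] at this
  linarith

/-- On a `σ`-compact group, relative Property (FH) implies relative Property (T). -/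
theorem RelativePropertyFH.relativePropertyT [IsTopologicalGroup G] [LocallyCompactSpace G]
    [SigmaCompactSpace G] {X : Set G} (h : RelativePropertyFH G X) : RelativePropertyT G X := by
  rw [relativePropertyT_iff]
  intro ε hε
  by_contra! hcon
  obtain ⟨ψ, hc, hψ, hunb⟩ := exists_isCondNegDefinite_unbounded hε hcon
  obtain ⟨C, hC⟩ := h.exists_bound hc hψ
  obtain ⟨x, hx, hlt⟩ := hunb C
  exact (hC x hx).not_gt hlt

end Relative

/-! ### Unitary representations and matrix coefficients -/

section Unitary

variable {G : Type*} [Group G] [TopologicalSpace G]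
  {H : Type*} [NormedAddCommGroup H] [InnerProductSpace ℂ H] (π : UnitaryRep G H)

theorem UnitaryRep.inner_apply_apply (g h : G) (ξ : H) :
    inner ℂ (π.toHom g ξ) (π.toHom h ξ) = inner ℂ ξ (π.toHom (g⁻¹ * h) ξ) := by
  rw [← (π.toHom g).inner_map_map ξ, ← Function.comp_apply (f := π.toHom g),
    ← LinearIsometryEquiv.coe_mul, ← map_mul, mul_inv_cancel_left]

theorem UnitaryRep.norm_sub_sq (g : G) {ξ : H} (hξ : ‖ξ‖ = 1) :
    ‖π.toHom g ξ - ξ‖ ^ 2 = 2 * (1 - (inner ℂ ξ (π.toHom g ξ)).re) := by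
  rw [_root_.norm_sub_sq (𝕜 := ℂ), LinearIsometryEquiv.norm_map, hξ, inner_re_symm,
    RCLike.re_to_complex]
  ring

/-- Matrix coefficients of unitary representations are positive definite. -/
theorem UnitaryRep.isPositiveDefinite_inner (ξ : H) :
    IsPositiveDefinite fun g => inner ℂ ξ (π.toHom g ξ) := by
  refine ⟨fun g => ?_, fun n g c => ?_⟩
  · have := π.inner_apply_apply g 1 ξ
    simp only [map_one, mul_one, LinearIsometryEquiv.coe_one, id] at this
    change inner ℂ ξ (π.toHom g ξ) = star (inner ℂ ξ (π.toHom g⁻¹ ξ))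
    rw [← this]
    exact (inner_conj_symm _ _).symm
  · have h1 : ∑ i, ∑ j, c i * star (c j) * inner ℂ ξ (π.toHom ((g i)⁻¹ * g j) ξ) =
        inner ℂ (∑ i, star (c i) • π.toHom (g i) ξ) (∑ i, star (c i) • π.toHom (g i) ξ) := by
      rw [sum_inner]
      refine Finset.sum_congr rfl fun i _ => ?_
      rw [inner_sum]
      refine Finset.sum_congr rfl fun j _ => ?_
      rw [inner_smul_left, inner_smul_right, π.inner_apply_apply]
      simp
      ring
    rw [h1]
    exact inner_self_nonneg (𝕜 := ℂ)

/-- The restriction of a unitary representation to an invariant subspace. -/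
def UnitaryRep.restrict (W : Submodule ℂ H) (hW : ∀ g, ∀ ξ ∈ W, π.toHom g ξ ∈ W) :
    UnitaryRep G W where
  toHom :=
    { toFun := fun g =>
        { toFun := fun ξ => ⟨π.toHom g ξ, hW g ξ ξ.2⟩
          invFun := fun ξ => ⟨π.toHom g⁻¹ ξ, hW g⁻¹ ξ ξ.2⟩
          left_inv := fun ξ => Subtype.ext (by simp)
          right_inv := fun ξ => Subtype.ext (by simp)
          map_add' := fun ξ η => Subtype.ext (by simp)
          map_smul' := fun c ξ => Subtype.ext (by simp)
          norm_map' := fun ξ => (π.toHom g).norm_map ξ }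
      map_one' := by
        ext ξ
        simp
      map_mul' := fun g h => by
        ext ξ
        simp }
  continuous_orbit := fun ξ => (π.continuous_orbit ξ).subtype_mk _

theorem UnitaryRep.orthogonal_invariant {W : Submodule ℂ H}
    (hW : ∀ g, ∀ ξ ∈ W, π.toHom g ξ ∈ W) (g : G) (ξ : H) (hξ : ξ ∈ Wᗮ) : π.toHom g ξ ∈ Wᗮ := by
  rw [Submodule.mem_orthogonal] at hξ ⊢
  intro η hη
  have h1 := hξ _ (hW g⁻¹ η hη)
  rw [← (π.toHom g).inner_map_map] at h1
  simpa using h1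

variable {Q : Type*} [Group Q] [TopologicalSpace Q] [IsTopologicalGroup Q] (f : G →ₜ* Q)

theorem UnitaryRep.qVectors_invariant (g : G) (ξ : H) (hξ : ξ ∈ π.qVectors f) :
    π.toHom g ξ ∈ π.qVectors f := by
  obtain ⟨w, hw, h⟩ := hξ
  refine ⟨fun q => w (q * f g), hw.comp (continuous_mul_const _), fun k => ?_⟩
  have := h (k * g)
  simp only [map_mul] at this
  exact this

end Unitary

/-! ### Resolutions and relative Property (T) -/

section Resolution

variable {G : Type u} {Q : Type v} [Group G] [TopologicalSpace G]
  [Group Q] [TopologicalSpace Q] [IsTopologicalGroup Q] {f : G →ₜ* Q} {hf : DenseRange f}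

/-- The images of finitely many translates of `f⁻¹ U` cover a relatively compact set. -/
theorem exists_finite_cover {G Q : Type*} [Group G] [TopologicalSpace G] [Group Q]
    [TopologicalSpace Q] [IsTopologicalGroup Q] {f : G →ₜ* Q} (hf : DenseRange f)
    {X : Set G} (hX : IsCompact (closure (f '' X))) {U : Set Q} (hU : U ∈ 𝓝 1) :
    ∃ F : Finset G, ∀ x ∈ X, ∃ g ∈ F, f (g⁻¹ * x) ∈ U := by
  have hU' : (1 : Q) ∈ interior U := mem_interior_iff_mem_nhds.2 hU
  obtain ⟨F, hF⟩ := hX.elim_finite_subcover (fun g : G => {q | (f g)⁻¹ * q ∈ interior U})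
    (fun g => isOpen_interior.preimage (continuous_const_mul _)) fun q _ => by
      obtain ⟨g, hg⟩ := hf.exists_mem_open (s := {r | r⁻¹ * q ∈ interior U})
        (isOpen_interior.preimage (by fun_prop)) ⟨q, by simpa using hU'⟩
      exact Set.mem_iUnion.2 ⟨g, hg⟩
  refine ⟨F, fun x hx => ?_⟩
  have := hF (subset_closure (Set.mem_image_of_mem f hx))
  simp only [Set.mem_iUnion, Set.mem_ofPred_eq, exists_prop] at this
  obtain ⟨g, hg, h⟩ := this
  exact ⟨g, hg, by simpa using interior_subset h⟩

/-- If `f` is a resolution, then a positive definite function close enough to `1` on a suitable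
compact set is close to `1` on the preimage of a neighborhood of `1` in `Q`. Otherwise there would
be unit vectors, in one representation `π`, that are almost invariant and yet far from the space of
`Q`-vectors. Their components orthogonal to that space would be almost invariant vectors of a
subrepresentation without `Q`-vectors. -/
theorem IsResolution.exists_re_ge [IsTopologicalGroup G] (h : IsResolution f hf) {ε : ℝ}
    (hε : 0 < ε) :
    ∃ K : Set G, IsCompact K ∧ ∃ δ : ℝ, 0 < δ ∧ ∀ φ : G → ℂ, Continuous φ →
      IsPositiveDefinite φ → φ 1 = 1 → (∀ g ∈ K, 1 - (φ g).re ≤ δ) →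
        ∃ U ∈ 𝓝 (1 : Q), ∀ g, f g ∈ U → 1 - ε ≤ (φ g).re := by
  by_contra! hcon
  choose φ hc hp h1 hK hU using fun i : {K : Set G // IsCompact K} × ℕ =>
    hcon i.1.1 i.1.2 (1 / ((i.2 : ℝ) + 1)) (by positivity)
  obtain ⟨H, _, _, _, π, ξ, hφ⟩ := exists_unitaryRep_of_isPositiveDefinite hc hp
  have hξ : ∀ i, ‖ξ i‖ = 1 := fun i => by
    have := hφ i 1
    rw [map_one, LinearIsometryEquiv.coe_one, id, h1] at this
    have h2 : ‖ξ i‖ ^ 2 = 1 := by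
      rw [← inner_self_eq_norm_sq (𝕜 := ℂ), this]
      simp
    exact (pow_eq_one_iff_of_nonneg (norm_nonneg _) two_ne_zero).1 h2
  have hnorm : ∀ i g, ‖π.toHom g (ξ i) - ξ i‖ ^ 2 = 2 * (1 - (φ i g).re) := fun i g => by
    rw [π.norm_sub_sq g (hξ i), hφ]
  set V := π.qVectors f
  have hV := π.qVectors_invariant f
  have hW := π.orthogonal_invariant hV
  have hWW := π.orthogonal_invariant hW
  let η : {K : Set G // IsCompact K} × ℕ → H := fun i => Vᗮ.starProjection (ξ i)
  have hηmem : ∀ i, η i ∈ Vᗮ := fun i => Submodule.starProjection_apply_mem _ _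
  have hηperp : ∀ i, ξ i - η i ∈ Vᗮᗮ := fun i => Vᗮ.sub_starProjection_mem_orthogonal (ξ i)
  -- a unit vector whose component in `Vᗮ` has norm less than `c` is within `2c` of a `Q`-vector
  set c : ℝ := √(2 * ε) / 5
  have hcpos : 0 < c := by positivity
  have hc2 : (5 * c) ^ 2 = 2 * ε := by
    rw [show 5 * c = √(2 * ε) by simp only [c]; ring, Real.sq_sqrt (by positivity)]
  have hfar : ∀ i, c ≤ ‖η i‖ := fun i => by
    by_contra! hlt
    have hcl : ξ i - η i ∈ V.topologicalClosure := by
      rw [← Submodule.orthogonal_orthogonal_eq_closure]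
      exact hηperp i
    obtain ⟨ζ, hζV, hζ⟩ := Metric.mem_closure_iff.1 hcl c hcpos
    obtain ⟨w, hw, hwζ⟩ := id hζV
    simp only at hwζ
    have hnear : ‖ξ i - ζ‖ ≤ 2 * c := by
      rw [dist_eq_norm] at hζ
      calc ‖ξ i - ζ‖ = ‖η i + (ξ i - η i - ζ)‖ := by congr 1; abel
        _ ≤ ‖η i‖ + ‖ξ i - η i - ζ‖ := norm_add_le _ _
        _ ≤ 2 * c := by linarith
    have hw1 : w 1 = ζ := by simpa using (hwζ 1).symm
    have hUn : {q | dist (w q) ζ < c} ∈ 𝓝 (1 : Q) :=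
      hw.continuousAt.preimage_mem_nhds (by rw [hw1]; exact Metric.ball_mem_nhds ζ hcpos)
    obtain ⟨g, hg, hlt⟩ := hU i _ hUn
    simp only [Set.mem_ofPred_eq, ← hwζ, dist_eq_norm] at hg
    have hbd : ‖π.toHom g (ξ i) - ξ i‖ ≤ 5 * c := by
      calc ‖π.toHom g (ξ i) - ξ i‖
          = ‖π.toHom g (ξ i - ζ) + (π.toHom g ζ - ζ) - (ξ i - ζ)‖ := by
            rw [map_sub]; congr 1; abel
        _ ≤ ‖π.toHom g (ξ i - ζ)‖ + ‖π.toHom g ζ - ζ‖ + ‖ξ i - ζ‖ :=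
            (norm_sub_le _ _).trans (by gcongr; exact norm_add_le _ _)
        _ ≤ 5 * c := by rw [LinearIsometryEquiv.norm_map]; linarith
    have h3 : ‖π.toHom g (ξ i) - ξ i‖ ^ 2 ≤ (5 * c) ^ 2 := by gcongr
    rw [hnorm, hc2] at h3
    linarith
  have hle : ∀ i g, ‖π.toHom g (η i) - η i‖ ≤ ‖π.toHom g (ξ i) - ξ i‖ := fun i g => by
    have hin : inner ℂ (π.toHom g (η i) - η i)
        (π.toHom g (ξ i - η i) - (ξ i - η i)) = 0 :=
      Submodule.inner_right_of_mem_orthogonal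
        (Submodule.sub_mem _ (hW g _ (hηmem i)) (hηmem i))
        (Submodule.sub_mem _ (hWW g _ (hηperp i)) (hηperp i))
    have h2 := norm_add_sq_eq_norm_sq_add_norm_sq_of_inner_eq_zero _ _ hin
    have h3 : π.toHom g (η i) - η i + (π.toHom g (ξ i - η i) - (ξ i - η i)) =
        π.toHom g (ξ i) - ξ i := by
      rw [map_sub]
      abel
    rw [h3] at h2
    refine abs_le_of_sq_le_sq' ?_ (norm_nonneg _) |>.2
    nlinarith [mul_self_nonneg ‖π.toHom g (ξ i - η i) - (ξ i - η i)‖]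
  have halmost : (π.restrict Vᗮ hW).AlmostHasInvariantVectors := by
    intro K hKc ε' hε'
    obtain ⟨n, hn⟩ := exists_nat_one_div_lt (show 0 < (ε' * c) ^ 2 / 2 by positivity)
    let i : {K : Set G // IsCompact K} × ℕ := (⟨K, hKc⟩, n)
    refine ⟨⟨η i, hηmem i⟩, fun h0 => ?_, fun g hg => ?_⟩
    · have := hfar i
      rw [show η i = 0 from congrArg Subtype.val h0, norm_zero] at this
      linarith
    · change ‖π.toHom g (η i) - η i‖ ≤ ε' * ‖η i‖
      have h2 := hnorm i g
      have h3 := hK i g hg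
      have h4 : ‖π.toHom g (ξ i) - ξ i‖ ≤ ε' * c := by
        refine abs_le_of_sq_le_sq' ?_ (by positivity) |>.2
        simp only [i] at h2 h3 ⊢
        linarith
      exact (hle i g).trans (h4.trans (by gcongr; exact hfar i))
  obtain ⟨⟨⟨ζ, hζW⟩, w, hw, hwζ⟩, hne, -⟩ := h _ _ halmost ∅ isCompact_empty 1 one_pos
  refine hne (Subtype.ext (Subtype.ext ?_))
  have hζV : ζ ∈ V := ⟨fun q => (w q : H), continuous_subtype_val.comp hw,
    fun g => congrArg Subtype.val (hwζ g)⟩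
  exact inner_self_eq_zero.1 ((Submodule.mem_orthogonal _ _).1 hζW ζ hζV)

/-- A resolution has relative Property (T) over relatively compact sets. A failure of relative
Property (T) yields a conditionally negative definite function `ψ`, unbounded on `X`, on an open
`σ`-compact subgroup `L` that contains `X`. But `exp (-tψ)`, extended by zero to `G`, is close to
`1` on the preimage of a neighborhood of `1` in `Q`, which bounds `ψ` there and hence on `X`. -/
theorem IsResolution.relativePropertyT [IsTopologicalGroup G] [LocallyCompactSpace G]
    (h : IsResolution f hf) {X : Set G} (hX : IsCompact (closure (f '' X))) :
    RelativePropertyT G X := by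
  rw [relativePropertyT_iff]
  intro ε hε
  by_contra! hcon
  obtain ⟨K, hK, δ, hδ, hres⟩ := h.exists_re_ge (ε := 1 / 2) (by norm_num)
  obtain ⟨V, hV, hV1⟩ := exists_compact_mem_nhds (1 : G)
  -- the indicator function of an open subgroup that contains `K` is `1` on `K`
  have hsub : ∃ U ∈ 𝓝 (1 : Q), ∀ g, f g ∈ U → g ∈ Subgroup.closure (V ∪ K) := by
    have hone : IsPositiveDefinite fun _ : Subgroup.closure (V ∪ K) => (1 : ℂ) := by
      have h0 : IsCondNegDefinite fun _ : Subgroup.closure (V ∪ K) => (0 : ℝ) := by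
        simp [IsCondNegDefinite]
      simpa using h0.isPositiveDefinite_exp zero_le_one
    obtain ⟨U, hU, hUg⟩ := hres _ (continuous_extendByZero (isOpen_subgroup_closure
      (mem_of_superset hV1 Set.subset_union_left)) continuous_const) hone.extendByZero
      (extendByZero_of_mem _ (Subgroup.one_mem _)) fun g hg => by
        have hgL : g ∈ Subgroup.closure (V ∪ K) := Subgroup.subset_closure (Or.inr hg)
        rw [extendByZero_of_mem _ hgL]
        simpa using hδ.le
    refine ⟨U, hU, fun g hg => ?_⟩
    by_contra hgL
    have := hUg g hg
    rw [extendByZero_of_notMem _ hgL] at this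
    norm_num at this
  obtain ⟨U₀, hU₀, hU₀L⟩ := hsub
  obtain ⟨F₀, hF₀⟩ := exists_finite_cover hf hX hU₀
  set A : Set G := V ∪ K ∪ F₀
  have hA : IsCompact A := (hV.union hK).union F₀.finite_toSet.isCompact
  set L := Subgroup.closure A
  have hLopen : IsOpen (L : Set G) := isOpen_subgroup_closure
    (mem_of_superset hV1 (Set.subset_union_left.trans Set.subset_union_left))
  have hLclosed := L.isClosed_of_isOpen hLopen
  have hKL : K ⊆ L := fun g hg => Subgroup.subset_closure (Or.inl (Or.inr hg))
  have hXL : X ⊆ L := fun x hx => by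
    obtain ⟨g, hg, hgx⟩ := hF₀ x hx
    have h1 : g ∈ L := Subgroup.subset_closure (Or.inr hg)
    have h2 : g⁻¹ * x ∈ L := Subgroup.closure_mono Set.subset_union_left (hU₀L _ hgx)
    simpa using L.mul_mem h1 h2
  have : SigmaCompactSpace L :=
    isSigmaCompact_iff_sigmaCompactSpace.1 (isSigmaCompact_subgroup_closure hA)
  have : LocallyCompactSpace L := hLclosed.locallyCompactSpace
  obtain ⟨ψ, hψc, hψ, hunb⟩ := exists_isCondNegDefinite_unbounded (G := L)
    (X := ((↑) : L → G) ⁻¹' X) hε fun C hC δ' hδ' => by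
      obtain ⟨φ, hc, hp, h1, hCφ, x, hx, hxφ⟩ :=
        hcon _ (hC.image continuous_subtype_val) δ' hδ'
      refine ⟨fun l => φ l, hc.comp continuous_subtype_val, ⟨fun g => hp.1 g,
        fun n g c => hp.2 n (fun i => g i) c⟩, h1, fun g hg => hCφ g ⟨g, hg, rfl⟩,
        ⟨x, hXL hx⟩, hx, hxφ⟩
  obtain ⟨t, ht, hKt⟩ := exists_exp_close hψc
    (hLclosed.isClosedEmbedding_subtypeVal.isCompact_preimage hK) hδ
  have hexp := hψ.isPositiveDefinite_exp ht.le
  obtain ⟨U, hU, hUg⟩ := hres _ (continuous_extendByZero hLopen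
    (φ := fun l => ((Real.exp (-(t * ψ l)) : ℝ) : ℂ)) (by fun_prop)) hexp.extendByZero
    (by
      rw [extendByZero_of_mem _ L.one_mem, show ψ ⟨1, L.one_mem⟩ = 0 from hψ.1]
      simp) fun g hg => by
      rw [extendByZero_of_mem _ (hKL hg), Complex.ofReal_re]
      exact hKt ⟨g, hKL hg⟩ hg
  have hbound : ∀ g, f g ∈ U → ∃ hg : g ∈ L, ψ ⟨g, hg⟩ ≤ Real.log 2 / t := fun g hg => by
    have h1 := hUg g hg
    by_cases hgL : g ∈ L
    · rw [extendByZero_of_mem _ hgL, Complex.ofReal_re] at h1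
      exact ⟨hgL, le_of_one_half_le_exp ht (by linarith)⟩
    · rw [extendByZero_of_notMem _ hgL] at h1
      norm_num at h1
  obtain ⟨F, hF⟩ := exists_finite_cover hf hX hU
  have hFfin : (((↑) : L → G) ⁻¹' (F : Set G)).Finite :=
    F.finite_toSet.preimage Subtype.val_injective.injOn
  obtain ⟨B, hB⟩ := (hFfin.image ψ).bddAbove
  obtain ⟨x, hx, hlt⟩ := hunb (2 * B + 2 * (Real.log 2 / t))
  obtain ⟨g, hg, hgx⟩ := hF x hx
  obtain ⟨hgxL, hgxψ⟩ := hbound _ hgx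
  have hgL : g ∈ L := by
    have := L.mul_mem x.2 (L.inv_mem hgxL)
    simpa using this
  have h1 := hψ.mul_le ⟨g, hgL⟩ ⟨g⁻¹ * x, hgxL⟩
  have h2 : (⟨g, hgL⟩ * ⟨g⁻¹ * x, hgxL⟩ : L) = x := Subtype.ext (by simp)
  have h3 : ψ ⟨g, hgL⟩ ≤ B := hB (Set.mem_image_of_mem ψ hg)
  rw [h2] at h1
  linarith

/-- Relative Property (T) makes an almost invariant vector of `G` almost invariant over the preimage
of a compact neighborhood in `Q`, where it can be replaced by a `Q`-vector nearby. -/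
theorem isResolution_of_relativePropertyT [LocallyCompactSpace Q] [T2Space Q] (hf : DenseRange f)
    (h : ∀ X : Set G, IsCompact (closure (f '' X)) → RelativePropertyT G X) :
    IsResolution f hf := by
  intro H _ _ _ π hπ K hK ε hε
  obtain ⟨C, hC, hKC⟩ := exists_compact_superset (hK.union (isCompact_singleton (x := (1 : Q))))
  have hX : IsCompact (closure (f '' (f ⁻¹' C))) :=
    hC.of_isClosed_subset isClosed_closure
      (closure_minimal (Set.image_preimage_subset f C) hC.isClosed)
  -- `r` is the bound on displacements over `C` that leaves room for moving the vector by `2r`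
  set r : ℝ := min (1 / 4) (ε / 10)
  have hr : 0 < r := by positivity
  have hr1 : r ≤ 1 / 4 := min_le_left _ _
  have hr2 : r ≤ ε / 10 := min_le_right _ _
  obtain ⟨D, hD, δ, hδ, hT⟩ := relativePropertyT_iff.1 (h _ hX) (r ^ 2 / 2) (by positivity)
  obtain ⟨ξ₀, hξ₀, hinv₀⟩ := hπ D hD (√(2 * δ)) (by positivity)
  set ξ : H := ((‖ξ₀‖⁻¹ : ℝ) : ℂ) • ξ₀
  have hξ : ‖ξ‖ = 1 := by
    rw [norm_smul, Complex.norm_real, norm_inv, norm_norm, inv_mul_cancel₀ (norm_ne_zero_iff.2 hξ₀)]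
  have hinv : ∀ g ∈ D, ‖π.toHom g ξ - ξ‖ ≤ √(2 * δ) := fun g hg => by
    rw [map_smul, ← smul_sub, norm_smul, Complex.norm_real, norm_inv, norm_norm,
      inv_mul_le_iff₀ (norm_pos_iff.2 hξ₀), mul_comm]
    exact hinv₀ g hg
  have hone : inner ℂ ξ (π.toHom 1 ξ) = (1 : ℂ) := by
    rw [map_one, LinearIsometryEquiv.coe_one, id, inner_self_eq_norm_sq_to_K, hξ]
    simp
  have hCr : ∀ g, f g ∈ C → dist (π.toHom g ξ) ξ ≤ r := fun g hg => by
    have h1 := hT _ (continuous_const.inner (π.continuous_orbit ξ)) (π.isPositiveDefinite_inner ξ)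
      hone (fun g hg => by
        have h2 := π.norm_sub_sq g hξ
        have h3 : ‖π.toHom g ξ - ξ‖ ^ 2 ≤ √(2 * δ) ^ 2 := by
          gcongr
          exact hinv g hg
        rw [Real.sq_sqrt (by positivity)] at h3
        linarith) g hg
    have h2 := π.norm_sub_sq g hξ
    rw [dist_eq_norm]
    refine abs_le_of_sq_le_sq' ?_ hr.le |>.2
    linarith
  let α : G →* (H ≃ᵢ H) :=
    { toFun := fun g => (π.toHom g).toIsometryEquiv
      map_one' := by ext x; simp
      map_mul' := fun g h => by ext x; simp }
  have hC1 : C ∈ 𝓝 (1 : Q) := mem_interior_iff_mem_nhds.1 (hKC (Or.inr rfl))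
  obtain ⟨y, hy, w, hw, hwy⟩ := exists_orbit_factors
    (semiParallelogramLaw_of_innerProductSpace ℂ (H := H)) (f : G →* Q) hf α ξ r hC1 hCr
  have hyQ : y ∈ π.qVectors f := ⟨w, hw, hwy⟩
  have hynorm : 1 / 2 ≤ ‖y‖ := by
    rw [dist_eq_norm] at hy
    have := norm_sub_norm_le ξ y
    rw [norm_sub_rev] at this
    linarith
  refine ⟨⟨y, hyQ⟩, fun h0 => ?_, fun q hq => ?_⟩
  · rw [show y = 0 from congrArg Subtype.val h0, norm_zero] at hynorm
    norm_num at hynorm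
  · change ‖π.qOrbit f ⟨y, hyQ⟩ q - y‖ ≤ ε * ‖y‖
    have hcont : Continuous fun q => ‖π.qOrbit f ⟨y, hyQ⟩ q - y‖ :=
      ((π.continuous_qOrbit _).sub continuous_const).norm
    have hqC : q ∈ interior C := hKC (Or.inl hq)
    have h5 : ‖π.qOrbit f ⟨y, hyQ⟩ q - y‖ ≤ 5 * r := by
      by_contra! hlt
      obtain ⟨g, hgC, hg⟩ := hf.exists_mem_open
        (isOpen_interior.inter (isOpen_lt continuous_const hcont)) ⟨q, hqC, hlt⟩
      simp only [Set.mem_ofPred_eq, π.qOrbit_apply] at hg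
      have h6 := hCr g (interior_subset hgC)
      rw [dist_eq_norm] at h6 hy
      have h7 : ‖π.toHom g y - y‖ ≤ 5 * r := by
        calc ‖π.toHom g y - y‖ = ‖π.toHom g (y - ξ) + (π.toHom g ξ - ξ) - (y - ξ)‖ := by
              rw [map_sub]; congr 1; abel
          _ ≤ ‖π.toHom g (y - ξ)‖ + ‖π.toHom g ξ - ξ‖ + ‖y - ξ‖ :=
              (norm_sub_le _ _).trans (by gcongr; exact norm_add_le _ _)
          _ ≤ 5 * r := by rw [LinearIsometryEquiv.norm_map]; linarith
      linarith
    nlinarith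

end Resolution

/-! ### Affine resolutions and relative Property (FH) -/

section Affine

section Displacement

variable {G : Type*} [Group G] {H P : Type*} [NormedAddCommGroup H] [InnerProductSpace ℝ H]
  [MetricSpace P] [NormedAddTorsor H P] (α : G →* (P ≃ᵃⁱ[ℝ] P)) (x : P)

theorem dist_action_inv_mul (g h : G) :
    dist (α (g⁻¹ * h) x) x = dist (α h x) (α g x) := by
  rw [← (α g).dist_map, ← Function.comp_apply (f := α g),
    ← AffineIsometryEquiv.coe_mul, ← map_mul, mul_inv_cancel_left]

/-- Squared displacement functions of isometric affine actions are conditionally negative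
definite. -/
theorem isCondNegDefinite_dist_sq : IsCondNegDefinite fun g => dist (α g x) x ^ 2 := by
  refine ⟨by simp, fun g => ?_, fun n g c hc => ?_⟩
  · have := dist_action_inv_mul α x g 1
    simp only [mul_one, map_one, AffineIsometryEquiv.coe_one, id] at this
    change dist (α g x) x ^ 2 = dist (α g⁻¹ x) x ^ 2
    rw [this, dist_comm]
  · have h1 := inner_sum_smul_sum_smul_of_sum_eq_zero (fun i => α (g i) x -ᵥ x) hc
      (fun i => α (g i) x -ᵥ x) hc
    have h2 : ∑ i, ∑ j, c i * c j * dist (α ((g i)⁻¹ * g j) x) x ^ 2 =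
        ∑ i, ∑ j, c i * c j * (‖(α (g i) x -ᵥ x) - (α (g j) x -ᵥ x)‖ *
          ‖(α (g i) x -ᵥ x) - (α (g j) x -ᵥ x)‖) := by
      refine Finset.sum_congr rfl fun i _ => Finset.sum_congr rfl fun j _ => ?_
      rw [dist_action_inv_mul, vsub_sub_vsub_cancel_right, ← dist_eq_norm_vsub, dist_comm, sq]
    rw [h2]
    have h3 := real_inner_self_nonneg (x := ∑ i, c i • (α (g i) x -ᵥ x))
    linarith

end Displacement

section QPoints

variable {G Q H P : Type*} [Group G] [TopologicalSpace G] [Group Q] [TopologicalSpace Q]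
  [NormedAddCommGroup H] [InnerProductSpace ℝ H] [MetricSpace P] [NormedAddTorsor H P]
  (α : G →* (P ≃ᵃⁱ[ℝ] P)) (f : G →ₜ* Q)

/-- The affine subspace of the points whose orbital map factors through `Q`. -/
def qPoints : AffineSubspace ℝ P where
  carrier := {x | FactorsThroughMor f fun g => α g x}
  smul_vsub_vadd_mem' := by
    rintro c x y z ⟨u, hu, hx⟩ ⟨v, hv, hy⟩ ⟨w, hw, hz⟩
    refine ⟨fun q => c • (u q -ᵥ v q) +ᵥ w q, ((hu.vsub hv).const_smul c).vadd hw, fun g => ?_⟩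
    simp only at hx hy hz ⊢
    rw [← hx, ← hy, ← hz, AffineIsometryEquiv.map_vadd, map_smul,
      AffineIsometryEquiv.map_vsub]

variable [IsTopologicalGroup Q] {α f}

/-- The action of `G` on the points whose orbital map factors through `Q` factors through a
continuous isometric action of `Q`: the element `q` acts by evaluating at `q` the extended orbital
maps. -/
theorem exists_action_on_qPoints (hf : DenseRange f) :
    ∃ β : Q →* (qPoints α f ≃ᵢ qPoints α f), (∀ x, Continuous fun q => β q x) ∧
      ∀ (g : G) (x : qPoints α f), ((β (f g) x : qPoints α f) : P) = α g x := by
  choose w hw hwα using fun x : qPoints α f => x.2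
  simp only at hwα
  have hone : ∀ x, w x 1 = x := fun x => by simpa using (hwα x 1).symm
  have huniq : ∀ (x : qPoints α f) (v : Q → P), Continuous v → (∀ g, v (f g) = α g x) →
      w x = v := fun x v hv h =>
    hf.equalizer (hw x) hv (funext fun g => by simp [h, ← hwα])
  have htrans : ∀ x g q, w x (f g * q) = α g (w x q) := fun x g q => by
    have : (fun q => w x (f g * q)) = fun q => α g (w x q) :=
      hf.equalizer ((hw x).comp (continuous_const_mul _)) ((α g).continuous.comp (hw x))
        (funext fun k => by
          simp only [Function.comp_apply, ← map_mul, ← hwα]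
          simp)
    exact congrFun this q
  have hmem : ∀ x q, w x q ∈ qPoints α f := fun x q =>
    ⟨fun r => w x (r * q), (hw x).comp (continuous_mul_const q), fun g => (htrans x g q).symm⟩
  have hmul : ∀ x q r, w ⟨w x r, hmem x r⟩ q = w x (q * r) := fun x q r =>
    congrFun (huniq _ (fun q => w x (q * r)) ((hw x).comp (continuous_mul_const r))
      fun g => htrans x g r) q
  have hdist : ∀ x y q, dist (w x q) (w y q) = dist (x : P) y := fun x y q => by
    have : (fun q => dist (w x q) (w y q)) = fun _ => dist (x : P) y :=
      hf.equalizer ((hw x).dist (hw y)) continuous_const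
        (funext fun g => by simp [← hwα])
    exact congrFun this q
  refine ⟨
    { toFun := fun q =>
        { toFun := fun x => ⟨w x q, hmem x q⟩
          invFun := fun x => ⟨w x q⁻¹, hmem x q⁻¹⟩
          left_inv := fun x => Subtype.ext (by simp [hmul, hone])
          right_inv := fun x => Subtype.ext (by simp [hmul, hone])
          isometry_toFun := Isometry.of_dist_eq fun x y => hdist x y q }
      map_one' := by
        ext x
        exact hone x
      map_mul' := fun q r => by
        ext x
        exact (hmul x q r).symm }, fun x => (hw x).subtype_mk _, fun g x => (hwα x g).symm⟩

end QPoints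

variable {G : Type u} {Q : Type v} [Group G] [TopologicalSpace G]
  [Group Q] [TopologicalSpace Q] {f : G →ₜ* Q}

/-- Relative Property (FH) bounds the orbital maps of an affine action over a compact neighborhood
in `Q`, and a weighted circumcenter provides a point whose orbital map factors through `Q`. -/
theorem isAffineResolution_of_relativePropertyFH [IsTopologicalGroup Q] [LocallyCompactSpace Q]
    [T2Space Q] (hf : DenseRange f)
    (h : ∀ X : Set G, IsCompact (closure (f '' X)) → RelativePropertyFH G X) :
    IsAffineResolution f := by
  intro H _ _ _ P _ _ α hα
  obtain ⟨x⟩ : Nonempty P := inferInstance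
  obtain ⟨C, hC, hC1⟩ := exists_compact_mem_nhds (1 : Q)
  have hX : IsCompact (closure (f '' (f ⁻¹' C))) :=
    hC.of_isClosed_subset isClosed_closure
      (closure_minimal (Set.image_preimage_subset f C) hC.isClosed)
  obtain ⟨B, hB⟩ := (h _ hX).exists_bound (((hα x).dist continuous_const).pow 2)
    (isCondNegDefinite_dist_sq α x)
  let α' : G →* (P ≃ᵢ P) :=
    { toFun := fun g => (α g).toIsometryEquiv
      map_one' := by ext x; simp
      map_mul' := fun g h => by ext x; simp }
  have : CompleteSpace P := (IsometryEquiv.vaddConst x).symm.completeSpace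
  obtain ⟨y, -, w, hw, hwy⟩ := exists_orbit_factors
    (semiParallelogramLaw_of_innerProductSpace ℝ (H := H)) (f : G →* Q) hf α' x (√B) hC1
    fun g hg => Real.le_sqrt_of_sq_le (hB g hg)
  obtain ⟨β, hβ, hβα⟩ := exists_action_on_qPoints (α := α) hf
  refine ⟨qPoints α f, ⟨y, w, hw, hwy⟩, fun g x hx => ?_, β, hβ, hβα⟩
  rw [← hβα g ⟨x, hx⟩]
  exact (β (f g) ⟨x, hx⟩).2

/-- In the affine action attached to a conditionally negative definite function, the displacements
of any two points differ by a bounded amount. -/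
theorem IsAffineResolution.relativePropertyFH [IsTopologicalGroup G] (h : IsAffineResolution f)
    {X : Set G} (hX : IsCompact (closure (f '' X))) : RelativePropertyFH G X := by
  refine relativePropertyFH_of_bound fun ψ hc hψ => ?_
  obtain ⟨H, _, _, _, α, hα, hαψ⟩ := hψ.exists_affine_action hc
  obtain ⟨V, ⟨v, hv⟩, -, β, hβ, hβα⟩ := h H H α hα
  have hcont : Continuous fun q => ‖((β q ⟨v, hv⟩ : V) : H) - v‖ :=
    ((continuous_subtype_val.comp (hβ _)).sub continuous_const).norm
  obtain ⟨B, hB⟩ := hX.bddAbove_image hcont.continuousOn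
  refine ⟨(B + 2 * ‖v‖) ^ 2, fun g hg => ?_⟩
  have h1 := hB (Set.mem_image_of_mem _ (subset_closure (Set.mem_image_of_mem f hg)))
  simp only [hβα] at h1
  have h2 : ‖α g 0‖ ≤ B + 2 * ‖v‖ := by
    have h3 : ‖α g 0 - α g v‖ = ‖v‖ := by
      rw [← dist_eq_norm, (α g).dist_map, dist_zero_left]
    calc ‖α g 0‖ = ‖(α g 0 - α g v) + (α g v - v) + v‖ := by congr 1; abel
      _ ≤ ‖α g 0 - α g v‖ + ‖α g v - v‖ + ‖v‖ := norm_add₃_le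
      _ ≤ B + 2 * ‖v‖ := by linarith
  rw [← hαψ]
  gcongr

end Affine

end RelativeT

theorem mainTheorem8 {G : Type u} {Q : Type v}
    [Group G] [TopologicalSpace G] [IsTopologicalGroup G] [LocallyCompactSpace G] [T2Space G]
    [Group Q] [TopologicalSpace Q] [IsTopologicalGroup Q] [LocallyCompactSpace Q] [T2Space Q]
    (f : G →ₜ* Q) (hf : DenseRange f) :
    -- a resolution has relative Property (T) over relatively compact subsets of `Q`
    (RelativeT.IsResolution f hf →
      ∀ X : Set G, IsCompact (closure (f '' X)) → RelativeT.RelativePropertyT G X) ∧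
    -- relative Property (T) for all these subsets implies relative Property (FH) for all of them
    ((∀ X : Set G, IsCompact (closure (f '' X)) → RelativeT.RelativePropertyT G X) →
      ∀ X : Set G, IsCompact (closure (f '' X)) → RelativeT.RelativePropertyFH G X) ∧
    -- the latter is equivalent to being an affine resolution
    ((∀ X : Set G, IsCompact (closure (f '' X)) → RelativeT.RelativePropertyFH G X) ↔
      RelativeT.IsAffineResolution f) ∧
    -- if `G` is `σ`-compact, all four conditions are equivalent
    (SigmaCompactSpace G →
      List.TFAE [
        RelativeT.IsResolution f hf,
        ∀ X : Set G, IsCompact (closure (f '' X)) → RelativeT.RelativePropertyT G X,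
        ∀ X : Set G, IsCompact (closure (f '' X)) → RelativeT.RelativePropertyFH G X,
        RelativeT.IsAffineResolution f]) := by
  have h12 : RelativeT.IsResolution f hf →
      ∀ X : Set G, IsCompact (closure (f '' X)) → RelativeT.RelativePropertyT G X :=
    fun h X hX => h.relativePropertyT hX
  have h23 : (∀ X : Set G, IsCompact (closure (f '' X)) → RelativeT.RelativePropertyT G X) →
      ∀ X : Set G, IsCompact (closure (f '' X)) → RelativeT.RelativePropertyFH G X :=
    fun h X hX => (h X hX).relativePropertyFH
  have h34 : (∀ X : Set G, IsCompact (closure (f '' X)) → RelativeT.RelativePropertyFH G X) ↔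
      RelativeT.IsAffineResolution f :=
    ⟨RelativeT.isAffineResolution_of_relativePropertyFH hf, fun h X hX => h.relativePropertyFH hX⟩
  refine ⟨h12, h23, h34, fun _ => ?_⟩
  tfae_have 1 → 2 := h12
  tfae_have 2 → 3 := h23
  tfae_have 3 ↔ 4 := h34
  tfae_have 3 → 2 := fun h X hX => (h X hX).relativePropertyT
  tfae_have 2 → 1 := RelativeT.isResolution_of_relativePropertyT hf
  tfae_finish
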